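/- Let $\lambda>0$, and consider a Poisson system of independent simple symmetric random walks on $\mathbb Z$: the numbers $\xi(0,y)$, $y\in\mathbb Z$, of particles at the sites $y$ at time $0$ are independent Poisson random variables with mean $\lambda$, and, independently of $(\xi(0,y))_{y\in\mathbb Z}$, the particles perform independent simple symmetric random walks $X^{y,i}=(X^{y,i}_n)_{n\ge 0}$ on $\mathbb Z$ (the $i$-th particle starting from $y$, $1\le i\le \xi(0,y)$). Let $$\xi(n,x)=\sum_{y\in\mathbb Z}\sum_{i=1}^{\xi(0,y)}\mathbf 1_{\{X^{y,i}_n=x\}}$$ be the number of particles at $x\in\mathbb Z$ at time $n\ge 0$. Let $A\subset\mathbb Z$ be finite and nonempty, and for $N\ge1$ let $$W_N(A)=\sum_{n=1}^N\sum_{x\in A}\xi(n,x),\qquad D_N(A)=\sum_{y\in\mathbb Z}\sum_{i=1}^{\xi(0,y)}\mathbf 1_{\{\exists\,1\le m\le N:\ X^{y,i}_m\in A\}}$$ be the cumulative occupation of $A$ and the number of distinct particles that visit $A$ at one of the times $1,\dots,N$. For every $N\ge1$ both variables are almost surely finite and square integrable with strictly positive variance; put $$F_N=\frac{W_N(A)-\mathbb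 E W_N(A)}{\sqrt{\operatorname{Var}(W_N(A))}},\qquad G_N=\frac{D_N(A)-\mathbb E D_N(A)}{\sqrt{\operatorname{Var}(D_N(A))}}.$$ Let $Z\sim\mathcal N(0,1)$ and let $d_W(F,Z)=\sup_h|\mathbb E h(F)-\mathbb E h(Z)|$, where the supremum runs over all $h:\mathbb R\to\mathbb R$ with Lipschitz constant at most $1$. Then there exist constants $C_1,C_2>0$, depending only on $\lambda$ and $A$, such that for all $N\ge1$: (a) $d_W(F_N,Z)\le C_1 N^{-1/4}$; (b) $d_W(G_N,Z)\le C_2 N^{-1/4}$. -/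

import Mathlib

open MeasureTheory ProbabilityTheory
open scoped ENNReal NNReal

namespace PoissonWalks

variable {Ω : Type*} [MeasurableSpace Ω]

/-- `S` is a simple symmetric random walk on `ℤ` started from `y`: it starts at `y` almost surely
and its increments are independent and equal to `1` or `-1` with probability `1 / 2` each. -/
structure IsSimpleRandomWalk (S : ℕ → Ω → ℤ) (y : ℤ) (P : Measure Ω) : Prop where
  measurable : ∀ n, Measurable (S n)
  start : ∀ᵐ ω ∂P, S 0 ω = y
  indep_steps : iIndepFun (fun n ω => S (n + 1) ω - S n ω) P
  step_up : ∀ n, P {ω | S (n + 1) ω - S n ω = 1} = 1 / 2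
  step_down : ∀ n, P {ω | S (n + 1) ω - S n ω = -1} = 1 / 2

/-- A Poisson system of independent simple symmetric random walks on `ℤ` with density `lam`:
`ξ₀ y` is the number of particles at `y` at time `0`, and `X y i n` is the position at time `n` of
the particle number `i` among those started from `y`. The particles present are those with
`i < ξ₀ y`; the walks `X y i` with larger `i` are spare copies that no observable uses. -/
structure IsPoissonWalkSystem (lam : ℝ≥0) (ξ₀ : ℤ → Ω → ℕ) (X : ℤ → ℕ → ℕ → Ω → ℤ)
    (P : Measure Ω) : Prop where
  measurable_init : ∀ y, Measurable (ξ₀ y)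
  law_init : ∀ y, P.map (ξ₀ y) = poissonMeasure lam
  indep_init : iIndepFun ξ₀ P
  walk : ∀ y i, IsSimpleRandomWalk (X y i) y P
  indep_walks : iIndepFun (fun (p : ℤ × ℕ) ω (n : ℕ) => X p.1 p.2 n ω) P
  indep_init_walks :
    IndepFun (fun ω (y : ℤ) => ξ₀ y ω) (fun ω (p : ℤ × ℕ) (n : ℕ) => X p.1 p.2 n ω) P

/-- The law of a fair `±1` step. -/
noncomputable def stepLaw : Measure ℤ :=
  (1 / 2 : ℝ≥0∞) • Measure.dirac 1 + (1 / 2 : ℝ≥0∞) • Measure.dirac (-1)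

instance : IsProbabilityMeasure stepLaw :=
  ⟨by simp [stepLaw, ENNReal.inv_two_add_inv_two]⟩

/-- The walk with starting point `y` and steps `s`. -/
def walkOfSteps (y : ℤ) (s : ℕ → ℤ) (n : ℕ) : ℤ := y + ∑ k ∈ Finset.range n, s k

theorem measurable_walkOfSteps (y : ℤ) : Measurable (walkOfSteps y) := by
  unfold walkOfSteps
  fun_prop

theorem iIndepFun_coord {ι α : Type*} [MeasurableSpace α] {P : Measure Ω}
    [IsProbabilityMeasure P] {μ : Measure α} [IsProbabilityMeasure μ] {f : Ω → ι → α}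
    (hf : MeasurePreserving f P (Measure.infinitePi fun _ => μ)) :
    iIndepFun (fun i ω => f ω i) P := by
  have hm : ∀ i, Measurable fun ω => f ω i := fun i => (measurable_pi_apply i).comp hf.measurable
  rw [iIndepFun_iff_map_fun_eq_infinitePi_map hm]
  have h : ∀ i, P.map (fun ω => f ω i) = μ := fun i =>
    ((measurePreserving_eval_infinitePi (fun _ => μ) i).comp hf).map_eq
  simp only [h]
  exact hf.map_eq

/-- Poisson systems of independent simple symmetric random walks exist, at every density. -/
theorem exists_isPoissonWalkSystem (lam : ℝ≥0) :
    ∃ (Ω : Type) (_ : MeasurableSpace Ω) (P : Measure Ω) (ξ₀ : ℤ → Ω → ℕ)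
      (X : ℤ → ℕ → ℕ → Ω → ℤ), IsProbabilityMeasure P ∧ IsPoissonWalkSystem lam ξ₀ X P := by
  let P₁ : Measure (ℤ → ℕ) := Measure.infinitePi (fun _ => poissonMeasure lam)
  let Q : Measure (ℕ → ℤ) := Measure.infinitePi (fun _ => stepLaw)
  let P₂ : Measure (ℤ × ℕ → ℕ → ℤ) := Measure.infinitePi (fun _ => Q)
  have h₁ : MeasurePreserving Prod.fst (P₁.prod P₂) P₁ := measurePreserving_fst
  have h₂ : MeasurePreserving Prod.snd (P₁.prod P₂) P₂ := measurePreserving_snd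
  have hs : ∀ p n, MeasurePreserving
      (fun ω : (ℤ → ℕ) × (ℤ × ℕ → ℕ → ℤ) => ω.2 p n) (P₁.prod P₂) stepLaw := fun p n =>
    (measurePreserving_eval_infinitePi (fun _ => stepLaw) n).comp
      ((measurePreserving_eval_infinitePi (fun _ => Q) p).comp h₂)
  have hval : ∀ p n (c : ℤ), (P₁.prod P₂)
      {ω : (ℤ → ℕ) × (ℤ × ℕ → ℕ → ℤ) | ω.2 p n = c} = stepLaw {c} := fun p n c =>
    (hs p n).measure_preimage (measurableSet_singleton c).nullMeasurableSet
  have hm : ∀ p : ℤ × ℕ, Measurable (walkOfSteps p.1) := fun p => measurable_walkOfSteps p.1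
  refine ⟨(ℤ → ℕ) × (ℤ × ℕ → ℕ → ℤ), inferInstance, P₁.prod P₂, fun y ω => ω.1 y,
    fun y i n ω => walkOfSteps y (ω.2 (y, i)) n, inferInstance, ?_, ?_, ?_, ?_, ?_, ?_⟩
  · intro y
    fun_prop
  · intro y
    exact ((measurePreserving_eval_infinitePi (fun _ => poissonMeasure lam) y).comp h₁).map_eq
  · exact iIndepFun_coord h₁
  · intro y i
    have hinc : ∀ n (ω : (ℤ → ℕ) × (ℤ × ℕ → ℕ → ℤ)),
        walkOfSteps y (ω.2 (y, i)) (n + 1) - walkOfSteps y (ω.2 (y, i)) n = ω.2 (y, i) n := by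
      intro n ω
      simp [walkOfSteps, Finset.sum_range_succ]
    refine ⟨?_, ?_, ?_, ?_, ?_⟩
    · intro n
      unfold walkOfSteps
      fun_prop
    · exact Filter.Eventually.of_forall fun ω => by simp [walkOfSteps]
    · simp only [hinc]
      exact iIndepFun_coord ((measurePreserving_eval_infinitePi (fun _ => Q) (y, i)).comp h₂)
    · intro n
      simp only [hinc, hval]
      simp [stepLaw]
    · intro n
      simp only [hinc, hval]
      simp [stepLaw]
  · exact (iIndepFun_coord h₂).comp (fun p => walkOfSteps p.1) hm
  · have h : IndepFun (fun ω : (ℤ → ℕ) × (ℤ × ℕ → ℕ → ℤ) => ω.1) (fun ω => ω.2) (P₁.prod P₂) :=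
      indepFun_prod measurable_id measurable_id
    exact h.comp (φ := fun f => f) (ψ := fun f p n => walkOfSteps p.1 (f p) n) measurable_id
      (by unfold walkOfSteps; fun_prop)

/-- The occupation field `ξ(n, x)`: the number of particles at `x` at time `n`. -/
noncomputable def occupation (ξ₀ : ℤ → Ω → ℕ) (X : ℤ → ℕ → ℕ → Ω → ℤ) (n : ℕ) (x : ℤ) (ω : Ω) :
    ℝ≥0∞ :=
  ∑' y : ℤ, ∑ i ∈ Finset.range (ξ₀ y ω), if X y i n ω = x then 1 else 0

/-- The cumulative occupation `W_N(A)` of `A` over the times `1, …, N`. -/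
noncomputable def cumulativeOccupation (ξ₀ : ℤ → Ω → ℕ) (X : ℤ → ℕ → ℕ → Ω → ℤ)
    (A : Finset ℤ) (N : ℕ) (ω : Ω) : ℝ≥0∞ :=
  ∑ n ∈ Finset.Icc 1 N, ∑ x ∈ A, occupation ξ₀ X n x ω

open Classical in
/-- The number `D_N(A)` of distinct particles that visit `A` at one of the times `1, …, N`. -/
noncomputable def distinctVisitors (ξ₀ : ℤ → Ω → ℕ) (X : ℤ → ℕ → ℕ → Ω → ℤ)
    (A : Finset ℤ) (N : ℕ) (ω : Ω) : ℝ≥0∞ :=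
  ∑' y : ℤ, ∑ i ∈ Finset.range (ξ₀ y ω), if ∃ m ∈ Finset.Icc 1 N, X y i m ω ∈ A then 1 else 0

/-- The standardization `(V - E V) / √(Var V)`. -/
noncomputable def standardize (V : Ω → ℝ) (P : Measure Ω) (ω : Ω) : ℝ :=
  (V ω - ∫ ω', V ω' ∂P) / √(Var[V; P])

/-- The Wasserstein distance of two laws on `ℝ` (with finite first moments): the supremum of
`|∫ h dμ - ∫ h dν|` over all functions `h` with Lipschitz constant at most `1`. -/
noncomputable def wassersteinDist (μ ν : Measure ℝ) : ℝ≥0∞ :=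
  ⨆ (h : ℝ → ℝ) (_ : LipschitzWith 1 h), ENNReal.ofReal |∫ x, h x ∂μ - ∫ x, h x ∂ν|

end PoissonWalks

/-!
# Normal approximation of the occupation of a finite set by a Poisson system of random walks

Let `L` be the number of visits of a walk to `A` at the times `1, …, N`. Both `W_N(A)` and
`D_N(A)` are sums over the particles of `g (L)`, with `g l = l` and `g l = min l 1` respectively.
Only particles starting at distance at most `N` from `A` contribute, so each is a finite sum over
sites of a Poisson number of independent marks, and has a compound Poisson law with some jump
intensity `κ` (`isCompoundPoisson_markSum`, by conditioning on the numbers of particles and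
computing the characteristic function).

**Normal approximation.** For a compound Poisson law `μ`, differentiating the characteristic
function gives `x μ(dx) = (y κ(dy)) ∗ μ` (`IsCompoundPoisson.sizeBiased_eq`). Hence the mean and
the variance are `∫ y dκ` and `∫ y² dκ`, and for the standardized variable `F`, the quantity `𝔼
[f'(F) - F f(F)]` is an integral of second order Taylor remainders of `f`, at most a constant
times `sup |f''| ∫ y³ dκ / (∫ y² dκ)^(3/2)`. Stein's method (`wassersteinDist_gaussianReal_le`)
turns this into a bound on the Wasserstein distance. The bounds on the solution `f` of the Stein
equation come from a comparison principle for `g' = x g + k` (`abs_le_of_stein_ode`), applied to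
`f` and then to `f'`.

**Moments.** The moments of `κ` are `λ ∑_y 𝔼_y [g(L)^k]`. By first-step analysis, and because
averaging over the two neighbours preserves sums over `ℤ`, these are sums over time of lower
moments at points of `A` (`tsum_visitMoment_two`, `tsum_visitMoment_three`). Everything reduces to
the expected local time at a point, which is of order `√N`: by the discrete Tanaka formula it is
the increment of `𝔼 |X_n|`, up to a bounded error (`localTime_le`, `le_localTime`). For `W_N(A)`
the second moment is at least of order `N^(3/2)` and the third at most of order `N²`; for `D_N(A)`
all moments agree and are at least of order `N^(1/2)`, because `∑_y 𝔼_y L = |A| N` while a walk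
that has hit `A` makes at most of order `√N` further visits. In both cases the ratio of the third
moment to the power `3/2` of the second is `O(N^(-1/4))`.
-/

namespace PoissonWalks

open Filter Topology Set

/-! ### Bounds on the solution of the Stein equation -/

theorem hasDerivAt_gaussian_kernel (x : ℝ) :
    HasDerivAt (fun x : ℝ => Real.exp (-x ^ 2 / 2)) (-x * Real.exp (-x ^ 2 / 2)) x := by
  have h := (((hasDerivAt_id x).pow 2).neg.div_const 2).exp
  convert! h using 1
  simp
  ring

theorem tendsto_gaussian_kernel : Tendsto (fun x : ℝ => Real.exp (-x ^ 2 / 2)) atTop (𝓝 0) := by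
  refine Real.tendsto_exp_atBot.comp ?_
  have h : Tendsto (fun x : ℝ => x ^ 2 / 2) atTop atTop :=
    (tendsto_pow_atTop two_ne_zero).atTop_div_const two_pos
  convert! tendsto_neg_atTop_atBot.comp h using 2
  simp [neg_div]

/-- A comparison principle for `g' = x g + k` on the half line: the only solution that is
negligible against `exp (x² / 2)` at infinity lies below any supersolution, and
`a + 2 c / (1 + x)` is one as soon as `-k ≤ a x + c`. -/
theorem le_of_stein_ode {g k : ℝ → ℝ} {a c : ℝ} (hc : 0 ≤ c)
    (hg : ∀ x, 0 ≤ x → HasDerivAt g (x * g x + k x) x)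
    (hlim : Tendsto (fun x => Real.exp (-x ^ 2 / 2) * g x) atTop (𝓝 0))
    (hk : ∀ x, 0 ≤ x → -(a * x + c) ≤ k x) {x : ℝ} (hx : 0 ≤ x) :
    g x ≤ a + 2 * c / (1 + x) := by
  set q : ℝ → ℝ := fun x => Real.exp (-x ^ 2 / 2) * (g x - (a + 2 * c / (1 + x))) with hq
  have hder : ∀ x, 0 ≤ x → HasDerivAt q (-x * Real.exp (-x ^ 2 / 2) * (g x - (a + 2 * c / (1 + x)))
      + Real.exp (-x ^ 2 / 2) * (x * g x + k x - (0 * (1 + x) - 2 * c * 1) / (1 + x) ^ 2)) x := by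
    intro x hx
    have h1 : HasDerivAt (fun x : ℝ => a + 2 * c / (1 + x))
        ((0 * (1 + x) - 2 * c * 1) / (1 + x) ^ 2) x :=
      ((hasDerivAt_const x (2 * c)).div ((hasDerivAt_id x).const_add 1)
        (by simp; positivity)).const_add a
    exact (hasDerivAt_gaussian_kernel x).mul ((hg x hx).sub h1)
  have hmono : MonotoneOn q (Ici 0) := by
    refine monotoneOn_of_deriv_nonneg (convex_Ici 0)
      (fun x hx => (hder x hx).continuousAt.continuousWithinAt)
      (fun x hx => (hder x (interior_subset hx)).differentiableAt.differentiableWithinAt) ?_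
    intro x hx
    have hx : 0 ≤ x := interior_subset hx
    rw [(hder x hx).deriv]
    have h2 : -x * Real.exp (-x ^ 2 / 2) * (g x - (a + 2 * c / (1 + x)))
      + Real.exp (-x ^ 2 / 2) * (x * g x + k x - (0 * (1 + x) - 2 * c * 1) / (1 + x) ^ 2)
      = Real.exp (-x ^ 2 / 2) * (k x + (a * x + c) + c * (x ^ 2 + 1) / (1 + x) ^ 2) := by
      have : 1 + x ≠ 0 := by positivity
      field_simp
      ring
    rw [h2]
    have := hk x hx
    have : 0 ≤ c * (x ^ 2 + 1) / (1 + x) ^ 2 := by positivity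
    exact mul_nonneg (Real.exp_nonneg _) (by linarith)
  have hqlim : Tendsto q atTop (𝓝 0) := by
    have h1 : Tendsto (fun x : ℝ => 2 * c / (1 + x)) atTop (𝓝 0) :=
      tendsto_const_nhds.div_atTop (tendsto_atTop_add_const_left _ _ tendsto_id)
    have h2 := hlim.sub (tendsto_gaussian_kernel.mul (h1.const_add a))
    simp only [zero_mul, sub_zero] at h2
    refine h2.congr fun x => ?_
    simp only [hq]
    ring
  have hq0 : q x ≤ 0 := by
    refine ge_of_tendsto hqlim ?_
    filter_upwards [eventually_ge_atTop x] with y hy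
    exact hmono hx (hx.trans hy) hy
  have := (mul_nonpos_iff_pos_imp_nonpos.1 hq0).1 (Real.exp_pos _)
  linarith

/-- Two-sided version of the comparison principle on the whole line. The decay of the bound in `|x|`
controls both `g x` and, when `a = 0`, the product `x g x`. -/
theorem abs_le_of_stein_ode {g k : ℝ → ℝ} {a c : ℝ} (hc : 0 ≤ c)
    (hg : ∀ x, HasDerivAt g (x * g x + k x) x)
    (htop : Tendsto (fun x => Real.exp (-x ^ 2 / 2) * g x) atTop (𝓝 0))
    (hbot : Tendsto (fun x => Real.exp (-x ^ 2 / 2) * g x) atBot (𝓝 0))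
    (hk : ∀ x, |k x| ≤ a * |x| + c) (x : ℝ) :
    |g x| ≤ a + 2 * c / (1 + |x|) := by
  have key : ∀ {g k : ℝ → ℝ}, (∀ x, HasDerivAt g (x * g x + k x) x) →
      Tendsto (fun x => Real.exp (-x ^ 2 / 2) * g x) atTop (𝓝 0) →
      (∀ x, |k x| ≤ a * |x| + c) → ∀ x, 0 ≤ x → |g x| ≤ a + 2 * c / (1 + x) := by
    intro g k hg htop hk x hx
    refine abs_le'.2 ⟨le_of_stein_ode hc (fun x _ => hg x) htop (fun x hx => ?_) hx,
      le_of_stein_ode (g := fun x => -g x) (k := fun x => -k x) hc (fun x _ => ?_) ?_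
        (fun x hx => ?_) hx⟩
    · have := hk x
      rw [abs_of_nonneg hx] at this
      exact (abs_le.1 this).1
    · convert! (hg x).neg using 1
      ring
    · simpa using htop.neg
    · have := hk x
      rw [abs_of_nonneg hx] at this
      exact neg_le_neg (abs_le.1 this).2
  rcases le_total 0 x with hx | hx
  · rw [abs_of_nonneg hx]
    exact key hg htop hk x hx
  · rw [abs_of_nonpos hx]
    -- the equation is invariant under `x ↦ -x`, with `k x` replaced by `-k (-x)`
    have := key (g := fun x => g (-x)) (k := fun x => -k (-x)) (fun y => ?_) ?_
      (fun y => by simpa using hk (-y)) (-x) (by linarith)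
    · simpa using this
    · have h := (hg (-y)).comp y (hasDerivAt_neg y)
      convert! h using 1
      ring
    · refine (hbot.comp tendsto_neg_atTop_atBot).congr fun y => ?_
      simp

theorem integrable_abs_gaussianReal : Integrable (fun x : ℝ => |x|) (gaussianReal 0 1) :=
  ((memLp_id_gaussianReal 1).integrable (by simp)).abs

theorem integral_abs_gaussianReal_le : ∫ x, |x| ∂(gaussianReal 0 1) ≤ 1 := by
  have h2 : Integrable (fun x : ℝ => x ^ 2) (gaussianReal 0 1) :=
    (memLp_id_gaussianReal 2).integrable_sq
  have hv : ∫ x, x ^ 2 ∂(gaussianReal 0 1) = 1 := by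
    have := variance_fun_id_gaussianReal (μ := 0) (v := 1)
    rw [variance_of_integral_eq_zero (by fun_prop) (by simp)] at this
    simpa using this
  calc ∫ x, |x| ∂(gaussianReal 0 1) ≤ ∫ x, (1 + x ^ 2) / 2 ∂(gaussianReal 0 1) := by
        refine integral_mono integrable_abs_gaussianReal
          (((integrable_const 1).add h2).div_const 2) fun x => ?_
        have := sq_nonneg (|x| - 1)
        simp only
        nlinarith [sq_abs x]
    _ = 1 := by
        rw [integral_div, integral_add (integrable_const 1) h2, hv]
        simp

theorem integrable_of_abs_sub_le {h : ℝ → ℝ} (hh : ∀ x y, |h x - h y| ≤ |x - y|)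
    {μ : Measure ℝ} [IsFiniteMeasure μ] (hμ : Integrable (fun x => x) μ) : Integrable h μ := by
  have hl : LipschitzWith 1 h := LipschitzWith.of_dist_le_mul fun x y => by
    simpa [Real.dist_eq] using hh x y
  refine (hμ.abs.add (integrable_const |h 0|)).mono hl.continuous.aestronglyMeasurable
    (Eventually.of_forall fun x => ?_)
  have h1 := hh x 0
  have h2 := abs_sub_abs_le_abs_sub (h x) (h 0)
  rw [sub_zero] at h1
  simp only [Pi.add_apply, Real.norm_eq_abs]
  rw [abs_of_nonneg (by positivity : 0 ≤ |x| + |h 0|)]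
  linarith

theorem abs_sub_integral_gaussianReal_le {h : ℝ → ℝ} (hh : ∀ x y, |h x - h y| ≤ |x - y|) (x : ℝ) :
    |h x - ∫ z, h z ∂(gaussianReal 0 1)| ≤ |x| + 1 := by
  have hi := integrable_of_abs_sub_le hh ((memLp_id_gaussianReal (μ := 0) (v := 1) 1).integrable
    (by simp))
  have h1 : h x - ∫ z, h z ∂(gaussianReal 0 1) = ∫ z, (h x - h z) ∂(gaussianReal 0 1) := by
    rw [integral_sub (integrable_const _) hi]
    simp
  rw [h1]
  calc |∫ z, (h x - h z) ∂(gaussianReal 0 1)| ≤ ∫ z, |h x - h z| ∂(gaussianReal 0 1) :=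
        abs_integral_le_integral_abs
    _ ≤ ∫ z, (|x| + |z|) ∂(gaussianReal 0 1) := by
        refine integral_mono ((integrable_const _).sub hi).abs
          ((integrable_const _).add integrable_abs_gaussianReal) fun z => ?_
        exact (hh x z).trans (abs_sub x z)
    _ ≤ |x| + 1 := by
        rw [integral_add (integrable_const _) integrable_abs_gaussianReal]
        simpa using integral_abs_gaussianReal_le

/-- The solution of the Stein equation `f' - x f = h - 𝔼 h(Z)` that is negligible against
`exp (x² / 2)` at both infinities. -/
theorem exists_stein_solution {h : ℝ → ℝ} (hh : ∀ x y, |h x - h y| ≤ |x - y|) :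
    ∃ f : ℝ → ℝ, (∀ x, HasDerivAt f (x * f x + (h x - ∫ z, h z ∂(gaussianReal 0 1))) x) ∧
      Tendsto (fun x => Real.exp (-x ^ 2 / 2) * f x) atTop (𝓝 0) ∧
      Tendsto (fun x => Real.exp (-x ^ 2 / 2) * f x) atBot (𝓝 0) := by
  set m := ∫ z, h z ∂(gaussianReal 0 1) with hm
  have hl : LipschitzWith 1 h := LipschitzWith.of_dist_le_mul fun x y => by
    simpa [Real.dist_eq] using hh x y
  have hcont := hl.continuous
  have hi := integrable_of_abs_sub_le hh ((memLp_id_gaussianReal (μ := 0) (v := 1) 1).integrable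
    (by simp))
  set u : ℝ → ℝ := fun x => Real.exp (-x ^ 2 / 2) * (h x - m) with hu
  have hucont : Continuous u := by fun_prop
  have hpdf : ∀ x : ℝ, gaussianPDFReal 0 1 x = (√(2 * Real.pi))⁻¹ * Real.exp (-x ^ 2 / 2) := by
    intro x
    simp [gaussianPDFReal]
  have hpi : √(2 * Real.pi) ≠ 0 := by positivity
  have huint : Integrable u := by
    have h1 : Integrable (fun x => h x - m) (gaussianReal 0 1) := hi.sub (integrable_const m)
    rw [gaussianReal_of_var_ne_zero 0 one_ne_zero,
      integrable_withDensity_iff_integrable_smul' (measurable_gaussianPDF 0 1)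
        (Eventually.of_forall fun x => gaussianPDF_lt_top)] at h1
    refine (h1.const_mul √(2 * Real.pi)).congr (Eventually.of_forall fun x => ?_)
    simp only [toReal_gaussianPDF, hpdf, smul_eq_mul, hu]
    field_simp
  have hu0 : ∫ x, u x = 0 := by
    have h1 : ∫ x, (h x - m) ∂(gaussianReal 0 1) = 0 := by
      rw [integral_sub hi (integrable_const m)]
      simp [hm]
    rw [integral_gaussianReal_eq_integral_smul one_ne_zero] at h1
    have h2 : ∀ x, u x = √(2 * Real.pi) * (gaussianPDFReal 0 1 x • (h x - m)) := by
      intro x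
      simp only [hpdf, smul_eq_mul, hu]
      field_simp
    simp_rw [h2]
    rw [integral_const_mul, h1, mul_zero]
  set c := ∫ x in Iic 0, u x with hc
  have hcI : c + ∫ x in Ioi 0, u x = 0 := by
    rw [hc, ← hu0, ← compl_Iic]
    exact integral_add_compl measurableSet_Iic huint
  have hprod : ∀ x : ℝ, Real.exp (-x ^ 2 / 2) * Real.exp (x ^ 2 / 2) = 1 := by
    intro x
    rw [← Real.exp_add]
    ring_nf
    exact Real.exp_zero
  have hE : ∀ x : ℝ, Real.exp (-x ^ 2 / 2) * (Real.exp (x ^ 2 / 2) * (c + ∫ t in (0 : ℝ)..x, u t))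
      = c + ∫ t in (0 : ℝ)..x, u t := by
    intro x
    rw [← mul_assoc, hprod, one_mul]
  refine ⟨fun x => Real.exp (x ^ 2 / 2) * (c + ∫ t in (0 : ℝ)..x, u t), fun x => ?_, ?_, ?_⟩
  · have h1 : HasDerivAt (fun x => c + ∫ t in (0 : ℝ)..x, u t) (u x) x :=
      (intervalIntegral.integral_hasDerivAt_right (hucont.intervalIntegrable _ _)
        hucont.stronglyMeasurable.stronglyMeasurableAtFilter hucont.continuousAt).const_add c
    have h2 : HasDerivAt (fun x : ℝ => Real.exp (x ^ 2 / 2)) (x * Real.exp (x ^ 2 / 2)) x := by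
      have h := (((hasDerivAt_id x).pow 2).div_const 2).exp
      convert! h using 1
      simp
      ring
    convert! h2.mul h1 using 1
    have := hprod x
    simp only [hu]
    linear_combination -(h x - m) * this
  · simp_rw [hE]
    have h1 := (intervalIntegral_tendsto_integral_Ioi 0 huint.integrableOn tendsto_id).const_add c
    rw [hcI] at h1
    exact h1
  · simp_rw [hE]
    have h1 := (intervalIntegral_tendsto_integral_Iic 0 huint.integrableOn tendsto_id).const_sub c
    rw [← hc, sub_self] at h1
    refine h1.congr fun x => ?_
    rw [intervalIntegral.integral_symm, sub_neg_eq_add]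
    simp

/-- A test function for Stein's method: the class to which the solutions of the Stein equation
for smooth `1`-Lipschitz functions belong. -/
structure IsSteinTestFunction (f f' : ℝ → ℝ) : Prop where
  hasDerivAt : ∀ x, HasDerivAt f (f' x) x
  abs_le : ∀ x, |f x| ≤ 3
  abs_deriv_le : ∀ x, |f' x| ≤ 8
  abs_deriv_sub_le : ∀ x y, |f' x - f' y| ≤ 12 * |x - y|

theorem exists_isSteinTestFunction {h h' : ℝ → ℝ} (hd : ∀ x, HasDerivAt h (h' x) x)
    (hb : ∀ x, |h' x| ≤ 1) :
    ∃ f f', IsSteinTestFunction f f' ∧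
      ∀ x, f' x - x * f x = h x - ∫ z, h z ∂(gaussianReal 0 1) := by
  have hh : ∀ x y, |h x - h y| ≤ |x - y| := by
    intro x y
    have := Convex.norm_image_sub_le_of_norm_hasDerivWithin_le (C := 1) (s := univ)
      (fun x _ => (hd x).hasDerivWithinAt) (fun x _ => hb x) convex_univ (mem_univ y) (mem_univ x)
    simpa using this
  obtain ⟨f, hf, htop, hbot⟩ := exists_stein_solution hh
  set m := ∫ z, h z ∂(gaussianReal 0 1)
  have hbound : ∀ x, |h x - m| ≤ 1 * |x| + 1 := fun x => by
    simpa using abs_sub_integral_gaussianReal_le hh x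
  have hf3 : ∀ x, |f x| ≤ 3 := fun x => by
    refine (abs_le_of_stein_ode zero_le_one hf htop hbot hbound x).trans ?_
    have : 2 * 1 / (1 + |x|) ≤ 2 := by
      rw [div_le_iff₀ (by positivity)]
      linarith [abs_nonneg x]
    linarith
  -- the derivative solves an equation of the same shape, with a bounded right-hand side
  set g : ℝ → ℝ := fun x => x * f x + (h x - m) with hg
  have hgd : ∀ x, HasDerivAt g (x * g x + (f x + h' x)) x := by
    intro x
    have := ((hasDerivAt_id x).mul (hf x)).add ((hd x).sub_const m)
    convert! this using 1
    simp [hg]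
    ring
  have hxlim : Tendsto (fun x : ℝ => x * Real.exp (-x ^ 2 / 2)) (cocompact ℝ) (𝓝 0) := by
    have := tendsto_rpow_abs_mul_exp_neg_mul_sq_cocompact (a := 1 / 2) (by norm_num) 1
    refine squeeze_zero_norm (fun x => ?_) this
    simp only [norm_mul, Real.norm_eq_abs, Real.abs_exp, Real.rpow_one]
    apply le_of_eq
    congr 2
    ring
  have hElim : Tendsto (fun x : ℝ => Real.exp (-x ^ 2 / 2)) (cocompact ℝ) (𝓝 0) := by
    have := tendsto_rpow_abs_mul_exp_neg_mul_sq_cocompact (a := 1 / 2) (by norm_num) 0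
    refine this.congr (fun x => ?_)
    simp only [Real.rpow_zero, one_mul]
    congr 1
    ring
  have hglim : Tendsto (fun x => Real.exp (-x ^ 2 / 2) * g x) (cocompact ℝ) (𝓝 0) := by
    have h1 := (hxlim.norm.const_mul 4).add hElim.norm
    simp only [norm_zero, mul_zero, add_zero] at h1
    refine squeeze_zero_norm (fun x => ?_) h1
    have h2 : |g x| ≤ 4 * |x| + 1 := by
      refine (abs_add_le _ _).trans ?_
      rw [abs_mul]
      have := hbound x
      nlinarith [hf3 x, abs_nonneg x]
    simp only [norm_mul, Real.norm_eq_abs, Real.abs_exp]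
    nlinarith [Real.exp_pos (-x ^ 2 / 2)]
  have hk : ∀ x, |f x + h' x| ≤ 0 * |x| + 4 := fun x => by
    refine (abs_add_le _ _).trans ?_
    linarith [hf3 x, hb x]
  have hgb := abs_le_of_stein_ode (by norm_num : (0 : ℝ) ≤ 4) hgd
    (hglim.mono_left atTop_le_cocompact) (hglim.mono_left atBot_le_cocompact) hk
  refine ⟨f, g, ⟨hf, hf3, fun x => (hgb x).trans ?_, fun x y => ?_⟩, fun x => by simp [hg]⟩
  · rw [zero_add, div_le_iff₀ (by positivity)]
    linarith [abs_nonneg x]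
  · have hd2 : ∀ x, |x * g x + (f x + h' x)| ≤ 12 := by
      intro x
      refine (abs_add_le _ _).trans ?_
      have h1 : |x * g x| ≤ 8 := by
        rw [abs_mul]
        calc |x| * |g x| ≤ |x| * (0 + 2 * 4 / (1 + |x|)) := by gcongr; exact hgb x
          _ = 8 * (|x| / (1 + |x|)) := by ring
          _ ≤ 8 * 1 := by
            gcongr
            rw [div_le_one (by positivity)]
            linarith
          _ = 8 := by norm_num
      linarith [hk x]
    have := Convex.norm_image_sub_le_of_norm_hasDerivWithin_le (C := 12) (s := univ)
      (fun x _ => (hgd x).hasDerivWithinAt) (fun x _ => hd2 x) convex_univ (mem_univ y) (mem_univ x)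
    simpa using this

/-- Stein's method for the Wasserstein distance. A Lipschitz function is a uniform limit of `C¹`
functions with the same Lipschitz constant, its averages over short intervals, so that it is enough
to solve the Stein equation for the latter. -/
theorem wassersteinDist_gaussianReal_le {μ : Measure ℝ} [IsProbabilityMeasure μ]
    (hμ : Integrable (fun x => x) μ) {δ : ℝ}
    (hδ : ∀ f f', IsSteinTestFunction f f' → |∫ x, (f' x - x * f x) ∂μ| ≤ δ) :
    wassersteinDist μ (gaussianReal 0 1) ≤ ENNReal.ofReal δ := by
  refine iSup₂_le fun h hl => ENNReal.ofReal_le_ofReal ?_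
  have hh : ∀ x y, |h x - h y| ≤ |x - y| := fun x y => by
    simpa [Real.dist_eq] using hl.dist_le_mul x y
  have hcont := hl.continuous
  have hγ : Integrable (fun x => x) (gaussianReal 0 1) :=
    (memLp_id_gaussianReal (μ := 0) (v := 1) 1).integrable (by simp)
  refine le_of_forall_pos_le_add fun ε' hε' => ?_
  obtain ⟨ε, hε, rfl⟩ : ∃ ε > 0, ε' = ε + ε := ⟨ε' / 2, by positivity, by ring⟩
  set H : ℝ → ℝ := fun x => ε⁻¹ * ∫ t in x..(x + ε), h t with hH
  have hint : ∀ a b, IntervalIntegrable h volume a b := fun a b => hcont.intervalIntegrable a b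
  have hHd : ∀ x, HasDerivAt H (ε⁻¹ * (h (x + ε) - h x)) x := by
    intro x
    have h1 : ∀ x, HasDerivAt (fun x => ∫ t in (0 : ℝ)..x, h t) (h x) x := fun x =>
      intervalIntegral.integral_hasDerivAt_right (hint _ _)
        hcont.stronglyMeasurable.stronglyMeasurableAtFilter hcont.continuousAt
    have h2 := (((h1 (x + ε)).comp_add_const x ε).sub (h1 x)).const_mul ε⁻¹
    refine h2.congr_of_eventuallyEq (Eventually.of_forall fun y => ?_)
    simp only [hH, Pi.sub_apply]
    rw [intervalIntegral.integral_interval_sub_left (hint _ _) (hint _ _)]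
  have hHb : ∀ x, |ε⁻¹ * (h (x + ε) - h x)| ≤ 1 := by
    intro x
    rw [abs_mul, abs_of_pos (inv_pos.2 hε), inv_mul_le_iff₀ hε, mul_one]
    refine (hh _ _).trans ?_
    simp [abs_of_pos hε]
  have hHh : ∀ x, |h x - H x| ≤ ε := by
    intro x
    have h1 : h x - H x = ε⁻¹ * ∫ t in x..(x + ε), (h x - h t) := by
      rw [intervalIntegral.integral_sub (by simp) (hint _ _)]
      simp only [intervalIntegral.integral_const, hH, add_sub_cancel_left, smul_eq_mul]
      field_simp
    rw [h1, abs_mul, abs_of_pos (inv_pos.2 hε), inv_mul_le_iff₀ hε]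
    have h2 := intervalIntegral.norm_integral_le_of_norm_le_const (a := x) (b := x + ε)
      (f := fun t => h x - h t) (C := ε) (fun t ht => ?_)
    · simpa [abs_of_pos hε] using h2
    · rw [uIoc_of_le (by linarith)] at ht
      refine (hh x t).trans ?_
      rw [abs_sub_comm, abs_of_pos (by linarith [ht.1])]
      linarith [ht.2]
  have hHl : ∀ x y, |H x - H y| ≤ |x - y| := by
    intro x y
    have := Convex.norm_image_sub_le_of_norm_hasDerivWithin_le (C := 1) (s := univ)
      (fun x _ => (hHd x).hasDerivWithinAt) (fun x _ => hHb x) convex_univ (mem_univ y) (mem_univ x)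
    simpa using this
  have hclose : ∀ (ν : Measure ℝ) [IsProbabilityMeasure ν], Integrable (fun x => x) ν →
      |∫ x, h x ∂ν - ∫ x, H x ∂ν| ≤ ε := by
    intro ν _ hν
    rw [← integral_sub (integrable_of_abs_sub_le hh hν) (integrable_of_abs_sub_le hHl hν)]
    have := norm_integral_le_of_norm_le_const (μ := ν) (f := fun x => h x - H x) (C := ε)
      (Eventually.of_forall hHh)
    simpa using this
  obtain ⟨f, f', hf, heq⟩ := exists_isSteinTestFunction hHd hHb
  have h1 := hδ f f' hf
  simp_rw [heq] at h1
  rw [integral_sub (integrable_of_abs_sub_le hHl hμ) (integrable_const _)] at h1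
  simp only [integral_const, probReal_univ, one_smul] at h1
  have h2 := hclose μ hμ
  have h3 := hclose _ hγ
  rw [abs_le] at h1 h2 h3 ⊢
  constructor <;> linarith [h1.1, h1.2, h2.1, h2.2, h3.1, h3.2]

/-! ### Normal approximation of compound Poisson laws -/

/-- `μ` is the compound Poisson law on `[0, ∞)` with finite jump intensity `κ`: the law of the sum
of the points of a Poisson process with intensity `κ`. It is described by its characteristic
function. The jumps are bounded, and the finiteness of the mean of `μ` is included. -/
structure IsCompoundPoisson (μ κ : Measure ℝ) : Prop where
  nonneg : ∀ᵐ x ∂μ, 0 ≤ x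
  integrable : Integrable (fun x => x) μ
  jump_nonneg : ∀ᵐ y ∂κ, 0 ≤ y
  jump_bounded : ∃ B : ℝ, ∀ᵐ y ∂κ, y ≤ B
  charFun_eq : ∀ t, charFun μ t = Complex.exp (charFun κ t - κ.real univ)

/-- The measure `x μ(dx)`, for `μ` carried by `[0, ∞)`. -/
noncomputable def sizeBiased (μ : Measure ℝ) : Measure ℝ := μ.withDensity fun x => ENNReal.ofReal x

theorem isFiniteMeasure_sizeBiased {μ : Measure ℝ} (hi : Integrable (fun x => x) μ) :
    IsFiniteMeasure (sizeBiased μ) :=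
  isFiniteMeasure_withDensity_ofReal hi.2

theorem integral_sizeBiased {μ : Measure ℝ} (h0 : ∀ᵐ x ∂μ, 0 ≤ x)
    {E : Type*} [NormedAddCommGroup E] [NormedSpace ℝ E] (f : ℝ → E) :
    ∫ x, f x ∂(sizeBiased μ) = ∫ x, x • f x ∂μ := by
  rw [sizeBiased, integral_withDensity_eq_integral_toReal_smul (by fun_prop)
    (Eventually.of_forall fun x => ENNReal.ofReal_lt_top)]
  refine integral_congr_ae ?_
  filter_upwards [h0] with x hx
  rw [ENNReal.toReal_ofReal hx]

theorem integrable_sizeBiased_iff {μ : Measure ℝ} (h0 : ∀ᵐ x ∂μ, 0 ≤ x)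
    {E : Type*} [NormedAddCommGroup E] [NormedSpace ℝ E] (f : ℝ → E) :
    Integrable f (sizeBiased μ) ↔ Integrable (fun x => x • f x) μ := by
  rw [sizeBiased, integrable_withDensity_iff_integrable_smul' (by fun_prop)
    (Eventually.of_forall fun x => ENNReal.ofReal_lt_top)]
  refine integrable_congr ?_
  filter_upwards [h0] with x hx
  rw [ENNReal.toReal_ofReal hx]

theorem hasDerivAt_charFun {μ : Measure ℝ} [IsFiniteMeasure μ] (hi : Integrable (fun x => x) μ)
    (h0 : ∀ᵐ x ∂μ, 0 ≤ x) (t : ℝ) :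
    HasDerivAt (charFun μ) (Complex.I * charFun (sizeBiased μ) t) t := by
  have hm : MemLp id ((1 : ℕ) : ℝ≥0∞) μ := by
    rw [Nat.cast_one, memLp_one_iff_integrable]
    exact hi
  have h1 := iteratedDeriv_charFun (t := t) hm
  have h2 : DifferentiableAt ℝ (charFun μ) t :=
    ((contDiff_charFun hm).differentiable (by simp)) t
  have h3 := h2.hasDerivAt
  rw [iteratedDeriv_one] at h1
  rw [h1] at h3
  convert! h3 using 1
  rw [charFun_apply_real, integral_sizeBiased h0, pow_one]
  simp

/-- The size-biasing relation, which is the form taken here by the Mecke formula: differentiate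
the characteristic function. -/
theorem IsCompoundPoisson.sizeBiased_eq {μ κ : Measure ℝ} [IsFiniteMeasure μ] [IsFiniteMeasure κ]
    (h : IsCompoundPoisson μ κ) : sizeBiased μ = (sizeBiased κ) ∗ μ := by
  obtain ⟨B, hB⟩ := h.jump_bounded
  have hκ : Integrable (fun x => x) κ := by
    refine Integrable.mono' (integrable_const B) (by fun_prop) ?_
    filter_upwards [hB, h.jump_nonneg] with y hy hy0
    rwa [Real.norm_of_nonneg hy0]
  have := isFiniteMeasure_sizeBiased h.integrable
  have := isFiniteMeasure_sizeBiased hκ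
  refine Measure.ext_of_charFun (funext fun t => ?_)
  rw [charFun_conv]
  have h1 := hasDerivAt_charFun h.integrable h.nonneg t
  have h2 := ((hasDerivAt_charFun hκ h.jump_nonneg t).sub_const (κ.real univ : ℂ)).cexp
  have h3 := h1.unique (h2.congr_of_eventuallyEq (Eventually.of_forall h.charFun_eq))
  rw [← h.charFun_eq t] at h3
  refine mul_left_cancel₀ Complex.I_ne_zero ?_
  linear_combination h3

theorem IsCompoundPoisson.integrable_jump_pow {μ κ : Measure ℝ} [IsFiniteMeasure κ]
    (h : IsCompoundPoisson μ κ) (n : ℕ) : Integrable (fun y => y ^ n) κ := by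
  obtain ⟨B, hB⟩ := h.jump_bounded
  refine Integrable.mono' (integrable_const (B ^ n)) (by fun_prop) ?_
  filter_upwards [hB, h.jump_nonneg] with y hy hy0
  rw [Real.norm_of_nonneg (by positivity)]
  exact pow_le_pow_left₀ hy0 hy n

theorem IsCompoundPoisson.integral_mul_eq {μ κ : Measure ℝ} [IsFiniteMeasure μ] [IsFiniteMeasure κ]
    (h : IsCompoundPoisson μ κ) {f : ℝ → ℝ} (hf : Integrable (fun x => x * f x) μ) :
    ∫ x, x * f x ∂μ = ∫ y, y * ∫ x, f (y + x) ∂μ ∂κ := by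
  have hκ : Integrable (fun x => x) κ := by simpa using h.integrable_jump_pow 1
  have := isFiniteMeasure_sizeBiased hκ
  have h1 : Integrable f (sizeBiased μ) := (integrable_sizeBiased_iff h.nonneg f).2 hf
  have h2 := integral_sizeBiased h.nonneg f
  simp only [smul_eq_mul] at h2
  rw [← h2]
  rw [h.sizeBiased_eq] at h1 ⊢
  rw [integral_conv h1, integral_sizeBiased h.jump_nonneg]
  simp

theorem IsCompoundPoisson.integral_eq {μ κ : Measure ℝ} [IsProbabilityMeasure μ]
    [IsFiniteMeasure κ] (h : IsCompoundPoisson μ κ) : ∫ x, x ∂μ = ∫ y, y ∂κ := by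
  have := h.integral_mul_eq (f := fun _ => 1) (by simpa using h.integrable)
  simpa using this

theorem IsCompoundPoisson.integrable_sq {μ κ : Measure ℝ} [IsProbabilityMeasure μ]
    [IsFiniteMeasure κ] (h : IsCompoundPoisson μ κ) : Integrable (fun x => x ^ 2) μ := by
  have hκ : Integrable (fun x => x) κ := by simpa using h.integrable_jump_pow 1
  have := isFiniteMeasure_sizeBiased hκ
  have h1 : Integrable (fun x : ℝ => x) (sizeBiased μ) := by
    rw [h.sizeBiased_eq, Measure.conv, integrable_map_measure (by fun_prop) (by fun_prop)]
    refine Integrable.add ?_ ?_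
    · have h2 : Integrable (fun y : ℝ => y) (sizeBiased κ) :=
        (integrable_sizeBiased_iff h.jump_nonneg _).2
          (by simpa [pow_two] using h.integrable_jump_pow 2)
      exact h2.comp_fst μ
    · exact h.integrable.comp_snd _
  simpa [pow_two] using (integrable_sizeBiased_iff h.nonneg _).1 h1

theorem IsCompoundPoisson.variance_eq {μ κ : Measure ℝ} [IsProbabilityMeasure μ]
    [IsFiniteMeasure κ] (h : IsCompoundPoisson μ κ) : Var[fun x => x; μ] = ∫ y, y ^ 2 ∂κ := by
  have hκ : Integrable (fun x => x) κ := by simpa using h.integrable_jump_pow 1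
  have h1 := h.integral_mul_eq (f := fun x => x) (by simpa [pow_two] using h.integrable_sq)
  have h2 : ∀ y, y * ∫ x, (y + x) ∂μ = y ^ 2 + (∫ x, x ∂μ) * y := by
    intro y
    rw [integral_add (integrable_const _) h.integrable]
    simp
    ring
  simp_rw [h2] at h1
  rw [integral_add (h.integrable_jump_pow 2) (hκ.const_mul _), integral_const_mul,
    ← h.integral_eq] at h1
  rw [variance_eq_sub ((memLp_two_iff_integrable_sq (by fun_prop)).2 h.integrable_sq)]
  simp only [Pi.pow_apply]
  simp_rw [← pow_two] at h1
  rw [h1]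
  ring

theorem IsSteinTestFunction.abs_taylor_le {f f' : ℝ → ℝ} (hf : IsSteinTestFunction f f')
    (x u : ℝ) : |f (x + u) - f x - u * f' x| ≤ 12 * u ^ 2 := by
  have h1 : ∀ t ∈ uIcc x (x + u), |f' t - f' x| ≤ 12 * |u| := by
    intro t ht
    refine (hf.abs_deriv_sub_le t x).trans ?_
    have := abs_sub_left_of_mem_uIcc ht
    rw [add_sub_cancel_left] at this
    gcongr
  have h2 : ∀ t, HasDerivAt (fun t => f t - t * f' x) (f' t - f' x) t := fun t => by
    have h := (hf.hasDerivAt t).sub ((hasDerivAt_id t).mul_const (f' x))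
    rw [one_mul] at h
    exact h
  have h3 := Convex.norm_image_sub_le_of_norm_hasDerivWithin_le (s := uIcc x (x + u))
    (fun t _ => (h2 t).hasDerivWithinAt) h1 (convex_uIcc _ _) left_mem_uIcc right_mem_uIcc
  simp only [Real.norm_eq_abs, add_sub_cancel_left] at h3
  have h4 : 12 * |u| * |u| = 12 * u ^ 2 := by rw [mul_assoc, abs_mul_abs_self, pow_two]
  rw [← h4]
  refine le_of_eq_of_le (congrArg _ ?_) h3
  ring

theorem IsSteinTestFunction.continuous {f f' : ℝ → ℝ} (hf : IsSteinTestFunction f f') :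
    Continuous f :=
  continuous_iff_continuousAt.2 fun x => (hf.hasDerivAt x).continuousAt

theorem IsSteinTestFunction.continuous_deriv {f f' : ℝ → ℝ} (hf : IsSteinTestFunction f f') :
    Continuous f' := by
  have : LipschitzWith 12 f' := LipschitzWith.of_dist_le_mul fun x y => by
    simpa [Real.dist_eq] using hf.abs_deriv_sub_le x y
  exact this.continuous

/-- The Stein discrepancy of a standardized compound Poisson law is a second order Taylor
remainder, integrated against the jumps. -/
theorem IsCompoundPoisson.abs_integral_stein_le {μ κ : Measure ℝ} [IsProbabilityMeasure μ]
    [IsFiniteMeasure κ] (h : IsCompoundPoisson μ κ) {σ m : ℝ} (hσ : 0 < σ)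
    (hσ2 : σ ^ 2 = ∫ y, y ^ 2 ∂κ) (hm : m = ∫ y, y ∂κ) {f f' : ℝ → ℝ}
    (hf : IsSteinTestFunction f f') :
    |∫ x, (f' ((x - m) / σ) - (x - m) / σ * f ((x - m) / σ)) ∂μ|
      ≤ 12 * (∫ y, y ^ 3 ∂κ) / σ ^ 3 := by
  have hκ : Integrable (fun x => x) κ := by simpa using h.integrable_jump_pow 1
  have hfc := hf.continuous
  have hfc' := hf.continuous_deriv
  have hif : ∀ u : ℝ, Integrable (fun x => f ((x - m) / σ + u)) μ := fun u =>
    Integrable.of_bound (by fun_prop) 3 (Eventually.of_forall fun x => hf.abs_le _)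
  have hif0 : Integrable (fun x => f ((x - m) / σ)) μ := by simpa using hif 0
  have hif' : Integrable (fun x => f' ((x - m) / σ)) μ :=
    Integrable.of_bound (by fun_prop) 8 (Eventually.of_forall fun x => hf.abs_deriv_le _)
  have hxf : Integrable (fun x => x * f ((x - m) / σ)) μ :=
    h.integrable.mul_bdd (c := 3) (by fun_prop) (Eventually.of_forall fun x => hf.abs_le _)
  set a := ∫ x, f ((x - m) / σ) ∂μ with ha
  set b := ∫ x, f' ((x - m) / σ) ∂μ with hb
  have h1 : ∫ x, x * f ((x - m) / σ) ∂μ = ∫ y, y * ∫ x, f ((x - m) / σ + y / σ) ∂μ ∂κ := by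
    rw [h.integral_mul_eq hxf]
    refine integral_congr_ae (Eventually.of_forall fun y => ?_)
    simp only
    congr 1
    refine integral_congr_ae (Eventually.of_forall fun x => ?_)
    simp only
    congr 1
    ring
  have hcont : Continuous fun y => ∫ x, f ((x - m) / σ + y / σ) ∂μ := by
    refine continuous_of_dominated (bound := fun _ => 3) (fun y => by fun_prop)
      (fun y => Eventually.of_forall fun x => hf.abs_le _) (integrable_const _)
      (Eventually.of_forall fun x => by fun_prop)
  have hi1 : Integrable (fun y => y * ∫ x, f ((x - m) / σ + y / σ) ∂μ) κ := by
    refine hκ.mul_bdd (c := 3) hcont.aestronglyMeasurable (Eventually.of_forall fun y => ?_)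
    have := norm_integral_le_of_norm_le_const (μ := μ) (f := fun x => f ((x - m) / σ + y / σ))
      (C := 3) (Eventually.of_forall fun x => hf.abs_le _)
    simpa using this
  have h2 : ∫ x, (f' ((x - m) / σ) - (x - m) / σ * f ((x - m) / σ)) ∂μ
      = ∫ y, -(y / σ) * ∫ x, (f ((x - m) / σ + y / σ) - f ((x - m) / σ)
          - y / σ * f' ((x - m) / σ)) ∂μ ∂κ := by
    have hL : ∫ x, (f' ((x - m) / σ) - (x - m) / σ * f ((x - m) / σ)) ∂μ
        = b - σ⁻¹ * (∫ x, x * f ((x - m) / σ) ∂μ - m * a) := by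
      have : ∀ x, f' ((x - m) / σ) - (x - m) / σ * f ((x - m) / σ) = f' ((x - m) / σ)
          - σ⁻¹ * (x * f ((x - m) / σ) - m * f ((x - m) / σ)) := fun x => by ring
      have hi : Integrable (fun x => x * f ((x - m) / σ) - m * f ((x - m) / σ)) μ :=
        hxf.sub (hif0.const_mul m)
      simp_rw [this]
      rw [integral_sub hif' (hi.const_mul _), integral_const_mul,
        integral_sub hxf (hif0.const_mul m), integral_const_mul]
    have hR : ∀ y, -(y / σ) * ∫ x, (f ((x - m) / σ + y / σ) - f ((x - m) / σ)
          - y / σ * f' ((x - m) / σ)) ∂μ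
        = (-σ⁻¹ * (y * ∫ x, f ((x - m) / σ + y / σ) ∂μ) + σ⁻¹ * a * y) + (σ⁻¹) ^ 2 * b * y ^ 2 := by
      intro y
      have hi : Integrable (fun x => f ((x - m) / σ + y / σ) - f ((x - m) / σ)) μ :=
        (hif _).sub hif0
      rw [integral_sub hi (hif'.const_mul _), integral_sub (hif _) hif0,
        integral_const_mul]
      ring
    have hi : Integrable (fun y => -σ⁻¹ * (y * ∫ x, f ((x - m) / σ + y / σ) ∂μ) + σ⁻¹ * a * y) κ :=
      (hi1.const_mul _).add (hκ.const_mul _)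
    simp_rw [hR]
    rw [integral_add hi ((h.integrable_jump_pow 2).const_mul _),
      integral_add (hi1.const_mul _) (hκ.const_mul _),
      integral_const_mul, integral_const_mul, integral_const_mul, hL, h1, ← hσ2, ← hm]
    field_simp
    ring
  rw [h2]
  have h3 : ∀ᵐ y ∂κ, ‖-(y / σ) * ∫ x, (f ((x - m) / σ + y / σ) - f ((x - m) / σ)
          - y / σ * f' ((x - m) / σ)) ∂μ‖ ≤ 12 / σ ^ 3 * y ^ 3 := by
    filter_upwards [h.jump_nonneg] with y hy
    have := norm_integral_le_of_norm_le_const (μ := μ) (f := fun x => f ((x - m) / σ + y / σ)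
      - f ((x - m) / σ) - y / σ * f' ((x - m) / σ)) (C := 12 * (y / σ) ^ 2)
      (Eventually.of_forall fun x => hf.abs_taylor_le _ _)
    rw [probReal_univ, mul_one] at this
    rw [norm_mul, norm_neg, Real.norm_of_nonneg (by positivity)]
    calc y / σ * _ ≤ y / σ * (12 * (y / σ) ^ 2) := by gcongr
      _ = 12 / σ ^ 3 * y ^ 3 := by field_simp
  refine (norm_integral_le_of_norm_le ((h.integrable_jump_pow 3).const_mul _) h3).trans_eq ?_
  rw [integral_const_mul]
  ring

theorem IsCompoundPoisson.wassersteinDist_le {μ κ : Measure ℝ} [IsProbabilityMeasure μ]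
    [IsFiniteMeasure κ] (h : IsCompoundPoisson μ κ) (hpos : 0 < ∫ y, y ^ 2 ∂κ) :
    wassersteinDist (μ.map (standardize (fun x => x) μ)) (gaussianReal 0 1)
      ≤ ENNReal.ofReal (12 * (∫ y, y ^ 3 ∂κ) / √(∫ y, y ^ 2 ∂κ) ^ 3) := by
  have hstd : standardize (fun x => x) μ = fun x => (x - ∫ y, y ∂κ) / √(∫ y, y ^ 2 ∂κ) := by
    funext x
    rw [standardize, h.variance_eq, h.integral_eq]
  have hmeas : Measurable fun x : ℝ => (x - ∫ y, y ∂κ) / √(∫ y, y ^ 2 ∂κ) := by fun_prop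
  rw [hstd]
  have : IsProbabilityMeasure (μ.map fun x => (x - ∫ y, y ∂κ) / √(∫ y, y ^ 2 ∂κ)) :=
    Measure.isProbabilityMeasure_map hmeas.aemeasurable
  refine wassersteinDist_gaussianReal_le ?_ fun f f' hf => ?_
  · rw [integrable_map_measure (by fun_prop) hmeas.aemeasurable]
    exact (h.integrable.sub (integrable_const _)).div_const _
  · have hfc := hf.continuous
    have hfc' := hf.continuous_deriv
    rw [integral_map hmeas.aemeasurable (by fun_prop)]
    exact h.abs_integral_stein_le (Real.sqrt_pos.2 hpos) (Real.sq_sqrt hpos.le) rfl hf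

/-! ### Poisson sums of independent marks are compound Poisson -/

theorem integral_pow_poissonMeasure (r : ℝ≥0) (z : ℂ) :
    ∫ n, z ^ n ∂(poissonMeasure r) = Complex.exp (r * (z - 1)) := by
  rw [integral_poissonMeasure r]
  calc ∑' n : ℕ, (Real.exp (-r) * r ^ n / (n.factorial : ℝ)) • z ^ n
      = ∑' n : ℕ, (Real.exp (-r) : ℂ) * ((r * z) ^ n / (n.factorial : ℂ)) := by
        congr with n
        rw [Complex.real_smul]
        push_cast
        rw [mul_pow]
        ring
    _ = Real.exp (-r) * Complex.exp (r * z) := by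
        rw [tsum_mul_left, (NormedSpace.expSeries_div_hasSum_exp ((r : ℂ) * z)).tsum_eq,
          Complex.exp_eq_exp_ℂ]
    _ = Complex.exp (r * (z - 1)) := by
        rw [Complex.ofReal_exp, ← Complex.exp_add]
        push_cast
        ring_nf

theorem integrable_cast_poissonMeasure (r : ℝ≥0) :
    Integrable (fun n : ℕ => (n : ℝ)) (poissonMeasure r) := by
  rw [integrable_poissonMeasure_iff]
  have h := ((Real.summable_pow_div_factorial (2 * r)).mul_left (Real.exp (-r)))
  refine h.of_nonneg_of_le (fun n => by positivity) fun n => ?_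
  have h1 : (n : ℝ) ≤ 2 ^ n := by exact_mod_cast Nat.lt_two_pow_self.le
  rw [Real.norm_natCast, mul_pow]
  calc Real.exp (-r) * (r : ℝ) ^ n / n.factorial * n
      ≤ Real.exp (-r) * (r : ℝ) ^ n / n.factorial * 2 ^ n := by gcongr
    _ = _ := by ring

/-- Finite Poisson sums of marks: at each of the finitely many sites `y ∈ S` there are `ξ y` marks
`Y y 0, Y y 1, …`. -/
noncomputable def markSum {Ω ι : Type*} (S : Finset ι) (ξ : ι → Ω → ℕ) (Y : ι → ℕ → Ω → ℝ)
    (ω : Ω) : ℝ :=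
  ∑ y ∈ S, ∑ i ∈ Finset.range (ξ y ω), Y y i ω

/-- The intensity measure of the marks on `S`, for sites with Poisson numbers of mean `lam`. -/
noncomputable def markIntensity {Ω ι : Type*} [MeasurableSpace Ω] (lam : ℝ≥0) (S : Finset ι)
    (Y : ι → ℕ → Ω → ℝ) (P : Measure Ω) : Measure ℝ :=
  ∑ y ∈ S, lam • P.map (Y y 0)

instance {Ω ι : Type*} [MeasurableSpace Ω] (lam : ℝ≥0) (S : Finset ι) (Y : ι → ℕ → Ω → ℝ)
    (P : Measure Ω) [IsProbabilityMeasure P] : IsFiniteMeasure (markIntensity lam S Y P) := by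
  unfold markIntensity
  infer_instance

section MarkSum

variable {Ω ι : Type*} [MeasurableSpace Ω] {P : Measure Ω}

theorem measurable_sum_range {α : Type*} [MeasurableSpace α] {n : α → ℕ} {f : ℕ → α → ℝ}
    (hn : Measurable n) (hf : ∀ i, Measurable (f i)) :
    Measurable fun a => ∑ i ∈ Finset.range (n a), f i a := by
  have h : Measurable fun p : ℕ × α => ∑ i ∈ Finset.range p.1, f i p.2 :=
    measurable_from_prod_countable_right fun k =>
      Finset.measurable_fun_sum (Finset.range k) fun i _ => hf i
  exact h.comp (hn.prodMk measurable_id)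

theorem measurable_markSum {S : Finset ι} {ξ : ι → Ω → ℕ} {Y : ι → ℕ → Ω → ℝ}
    (hξm : ∀ y, Measurable (ξ y)) (hYm : ∀ y i, Measurable (Y y i)) :
    Measurable (markSum S ξ Y) :=
  Finset.measurable_fun_sum _ fun y _ => measurable_sum_range (hξm y) (hYm y)

theorem integral_markIntensity [IsProbabilityMeasure P] {lam : ℝ≥0} {S : Finset ι}
    {Y : ι → ℕ → Ω → ℝ} (hYm : ∀ y i, Measurable (Y y i)) {E : Type*} [NormedAddCommGroup E]
    [NormedSpace ℝ E] {f : ℝ → E} (hf : StronglyMeasurable f)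
    (hfi : ∀ y, Integrable (fun ω => f (Y y 0 ω)) P) :
    ∫ x, f x ∂(markIntensity lam S Y P) = ∑ y ∈ S, lam • ∫ ω, f (Y y 0 ω) ∂P := by
  rw [markIntensity, integral_finsetSum_measure fun y _ => ?_]
  · refine Finset.sum_congr rfl fun y _ => ?_
    rw [integral_smul_nnreal_measure, integral_map (hYm y 0).aemeasurable
      hf.aestronglyMeasurable]
  · refine Integrable.smul_measure_nnreal ?_
    rw [integrable_map_measure hf.aestronglyMeasurable (hYm y 0).aemeasurable]
    exact hfi y

theorem ae_markIntensity {lam : ℝ≥0} {S : Finset ι} {Y : ι → ℕ → Ω → ℝ}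
    (hYm : ∀ y i, Measurable (Y y i)) {p : ℝ → Prop} (hp : MeasurableSet {x | p x})
    (h : ∀ y ω, p (Y y 0 ω)) : ∀ᵐ x ∂(markIntensity lam S Y P), p x := by
  rw [ae_iff, markIntensity, Measure.finsetSum_apply]
  refine Finset.sum_eq_zero fun y _ => ?_
  have h1 : (P.map (Y y 0)) {x | ¬p x} = 0 := by
    refine (Measure.map_apply (hYm y 0) hp.compl).trans ?_
    have h2 : Y y 0 ⁻¹' {x | p x}ᶜ = ∅ := by
      ext ω
      simp [h]
    rw [h2, measure_empty]
  rw [Measure.smul_apply, h1, smul_zero]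

/-- Conditionally on the numbers of marks, which are independent of the marks, the characteristic
function is a product of powers; the powers are then averaged over the Poisson numbers. -/
theorem charFun_markSum [IsProbabilityMeasure P] {lam : ℝ≥0} {S : Finset ι} {ξ : ι → Ω → ℕ}
    {Y : ι → ℕ → Ω → ℝ} (hξm : ∀ y, Measurable (ξ y))
    (hξ : ∀ y, P.map (ξ y) = poissonMeasure lam) (hξi : iIndepFun ξ P)
    (hYm : ∀ y i, Measurable (Y y i)) (hYlaw : ∀ y i, P.map (Y y i) = P.map (Y y 0))
    (hYi : iIndepFun (fun p : ι × ℕ => Y p.1 p.2) P)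
    (hξY : IndepFun (fun ω y => ξ y ω) (fun ω (p : ι × ℕ) => Y p.1 p.2 ω) P) (t : ℝ) :
    charFun (P.map (markSum S ξ Y)) t
      = ∏ y ∈ S, Complex.exp (lam * (charFun (P.map (Y y 0)) t - 1)) := by
  set F : (ι → ℕ) × (ι × ℕ → ℝ) → ℂ := fun q =>
    Complex.exp (t * (markSum S (fun y q => q.1 y) (fun y i q => q.2 (y, i)) q : ℝ) * Complex.I)
    with hF
  have hmF : Measurable F := by
    have := measurable_markSum (S := S) (ξ := fun y (q : (ι → ℕ) × (ι × ℕ → ℝ)) => q.1 y)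
      (Y := fun y i q => q.2 (y, i)) (fun y => by fun_prop) (fun y i => by fun_prop)
    fun_prop
  have hmξ : Measurable fun ω y => ξ y ω := measurable_pi_lambda _ hξm
  have hmY : Measurable fun ω (p : ι × ℕ) => Y p.1 p.2 ω :=
    measurable_pi_lambda _ fun p => hYm p.1 p.2
  have : IsProbabilityMeasure (P.map fun ω y => ξ y ω) :=
    Measure.isProbabilityMeasure_map hmξ.aemeasurable
  have : IsProbabilityMeasure (P.map fun ω (p : ι × ℕ) => Y p.1 p.2 ω) :=
    Measure.isProbabilityMeasure_map hmY.aemeasurable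
  have h1 : charFun (P.map (markSum S ξ Y)) t
      = ∫ k, ∫ z, F (k, z) ∂(P.map fun ω (p : ι × ℕ) => Y p.1 p.2 ω) ∂(P.map fun ω y => ξ y ω) := by
    rw [charFun_apply_real, integral_map (measurable_markSum hξm hYm).aemeasurable (by fun_prop),
      ← integral_prod, ← (indepFun_iff_map_prod_eq_prod_map_map hmξ.aemeasurable
        hmY.aemeasurable).1 hξY, integral_map (hmξ.prodMk hmY).aemeasurable
        hmF.aestronglyMeasurable]
    · rfl
    · refine Integrable.of_bound hmF.aestronglyMeasurable 1 (Eventually.of_forall fun q => ?_)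
      simp only [hF]
      rw [← Complex.ofReal_mul, Complex.norm_exp_ofReal_mul_I]
  have h2 : ∀ k : ι → ℕ, ∫ z, F (k, z) ∂(P.map fun ω (p : ι × ℕ) => Y p.1 p.2 ω)
      = ∏ y ∈ S, charFun (P.map (Y y 0)) t ^ k y := by
    intro k
    have hmFk : Measurable fun z => F (k, z) := hmF.comp measurable_prodMk_left
    rw [integral_map hmY.aemeasurable hmFk.aestronglyMeasurable]
    have hinj : Function.Injective fun q : (_ : ι) × ℕ => (q.1, q.2) := by
      rintro ⟨a, b⟩ ⟨c, d⟩ hq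
      simpa using hq
    have hi := hYi.precomp hinj
    have h3 := (hi.restrict (S.sigma fun y => Finset.range (k y))).charFun_map_fun_finsetSum_eq_prod
      (fun q _ => (hYm q.1 q.2).aemeasurable)
    have h4 := congrFun h3 t
    rw [charFun_apply_real, integral_map (by
      exact (Finset.measurable_fun_sum _ fun q _ => hYm q.1 q.2).aemeasurable) (by fun_prop)] at h4
    simp only [Finset.prod_apply, Finset.prod_sigma, hYlaw, Finset.prod_const,
      Finset.card_range, Finset.sum_sigma] at h4
    rw [← h4]
    rfl
  simp_rw [h1, h2]
  have hpow : ∀ y, Measurable fun n : ℕ => charFun (P.map (Y y 0)) t ^ n := fun y => by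
    fun_prop
  have hprod : Measurable fun k : ι → ℕ => ∏ y ∈ S, charFun (P.map (Y y 0)) t ^ k y :=
    Finset.measurable_fun_prod _ fun y _ => (hpow y).comp (measurable_pi_apply y)
  rw [integral_map hmξ.aemeasurable hprod.aestronglyMeasurable]
  have h5 := (hξi.restrict S).integral_fun_prod_comp (X := S.restrict ξ)
    (f := fun y n => charFun (P.map (Y y 0)) t ^ n)
    (fun y => (hξm y).aemeasurable) (fun y => (hpow y).aestronglyMeasurable)
  simp only [Finset.restrict] at h5
  rw [Finset.prod_coe_sort S fun y => ∫ ω, charFun (P.map (Y y 0)) t ^ ξ y ω ∂P] at h5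
  have h6 : ∀ ω, ∏ y : S, charFun (P.map (Y y 0)) t ^ ξ y ω
      = ∏ y ∈ S, charFun (P.map (Y y 0)) t ^ ξ y ω := fun ω =>
    Finset.prod_coe_sort S fun y => charFun (P.map (Y y 0)) t ^ ξ y ω
  simp_rw [h6] at h5
  rw [h5]
  refine Finset.prod_congr rfl fun y _ => ?_
  rw [← integral_pow_poissonMeasure, ← hξ y, integral_map (hξm y).aemeasurable (by fun_prop)]

theorem isCompoundPoisson_markSum [IsProbabilityMeasure P] {lam : ℝ≥0} {S : Finset ι}
    {ξ : ι → Ω → ℕ} {Y : ι → ℕ → Ω → ℝ} (hξm : ∀ y, Measurable (ξ y))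
    (hξ : ∀ y, P.map (ξ y) = poissonMeasure lam) (hξi : iIndepFun ξ P)
    (hYm : ∀ y i, Measurable (Y y i)) (hYlaw : ∀ y i, P.map (Y y i) = P.map (Y y 0))
    (hYi : iIndepFun (fun p : ι × ℕ => Y p.1 p.2) P)
    (hξY : IndepFun (fun ω y => ξ y ω) (fun ω (p : ι × ℕ) => Y p.1 p.2 ω) P)
    (hY0 : ∀ y i ω, 0 ≤ Y y i ω) {B : ℝ} (hYB : ∀ y i ω, Y y i ω ≤ B) :
    IsCompoundPoisson (P.map (markSum S ξ Y)) (markIntensity lam S Y P) := by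
  have hm := measurable_markSum (S := S) hξm hYm
  have h0 : ∀ ω, 0 ≤ markSum S ξ Y ω := fun ω =>
    Finset.sum_nonneg fun y _ => Finset.sum_nonneg fun i _ => hY0 y i ω
  refine ⟨?_, ?_, ?_, ⟨B, ?_⟩, fun t => ?_⟩
  · rw [ae_map_iff hm.aemeasurable measurableSet_Ici]
    exact Eventually.of_forall h0
  · rw [integrable_map_measure (by fun_prop) hm.aemeasurable]
    have hint : Integrable (fun ω => ∑ y ∈ S, (ξ y ω : ℝ) * B) P := by
      refine integrable_finsetSum _ fun y _ => Integrable.mul_const ?_ B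
      have := integrable_cast_poissonMeasure lam
      rw [← hξ y, integrable_map_measure (by fun_prop) (hξm y).aemeasurable] at this
      exact this
    refine hint.mono' hm.aestronglyMeasurable (Eventually.of_forall fun ω => ?_)
    simp only [Function.comp_apply]
    rw [Real.norm_of_nonneg (h0 ω)]
    refine Finset.sum_le_sum fun y _ => ?_
    refine (Finset.sum_le_sum fun i _ => hYB y i ω).trans ?_
    simp
  · exact ae_markIntensity hYm measurableSet_Ici fun y ω => hY0 y 0 ω
  · exact ae_markIntensity hYm measurableSet_Iic fun y ω => hYB y 0 ω
  · rw [charFun_markSum hξm hξ hξi hYm hYlaw hYi hξY, ← Complex.exp_sum]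
    have h1 : (markIntensity lam S Y P).real univ = ∑ y ∈ S, (lam : ℝ) := by
      have := integral_markIntensity (P := P) (lam := lam) (S := S) (Y := Y) (f := fun _ => (1 : ℝ))
        hYm stronglyMeasurable_const (fun y => integrable_const _)
      simpa [NNReal.smul_def] using this
    rw [h1, charFun_apply_real, integral_markIntensity hYm (by fun_prop) fun y => ?_]
    · congr 1
      push_cast
      rw [← Finset.sum_sub_distrib]
      refine Finset.sum_congr rfl fun y _ => ?_
      rw [charFun_apply_real, integral_map (hYm y 0).aemeasurable (by fun_prop), NNReal.smul_def,
        Complex.real_smul]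
      ring
    · have := hYm y 0
      refine Integrable.of_bound (by fun_prop) 1 (Eventually.of_forall fun ω => ?_)
      rw [← Complex.ofReal_mul, Complex.norm_exp_ofReal_mul_I]

/-- Normal approximation of a random variable that is almost surely a Poisson sum of marks, in
terms of the second and third moments `M₂`, `M₃` of the mark intensity. -/
theorem normal_approx_of_ae_eq_markSum [IsProbabilityMeasure P] {lam : ℝ≥0} {S : Finset ι}
    {ξ : ι → Ω → ℕ} {Y : ι → ℕ → Ω → ℝ} (hξm : ∀ y, Measurable (ξ y))
    (hξ : ∀ y, P.map (ξ y) = poissonMeasure lam) (hξi : iIndepFun ξ P)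
    (hYm : ∀ y i, Measurable (Y y i)) (hYlaw : ∀ y i, P.map (Y y i) = P.map (Y y 0))
    (hYi : iIndepFun (fun p : ι × ℕ => Y p.1 p.2) P)
    (hξY : IndepFun (fun ω y => ξ y ω) (fun ω (p : ι × ℕ) => Y p.1 p.2 ω) P)
    (hY0 : ∀ y i ω, 0 ≤ Y y i ω) {B : ℝ} (hYB : ∀ y i ω, Y y i ω ≤ B)
    {V : Ω → ℝ} (hV : V =ᵐ[P] markSum S ξ Y) {M₂ M₃ : ℝ} (hpos : 0 < M₂)
    (h2 : M₂ = lam * ∑ y ∈ S, ∫ ω, Y y 0 ω ^ 2 ∂P)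
    (h3 : M₃ = lam * ∑ y ∈ S, ∫ ω, Y y 0 ω ^ 3 ∂P) :
    MemLp V 2 P ∧ 0 < Var[V; P] ∧
      wassersteinDist (P.map (standardize V P)) (gaussianReal 0 1)
        ≤ ENNReal.ofReal (12 * M₃ / √M₂ ^ 3) := by
  have h := isCompoundPoisson_markSum (S := S) hξm hξ hξi hYm hYlaw hYi hξY hY0 hYB
  have hm := measurable_markSum (S := S) hξm hYm
  have : IsProbabilityMeasure (P.map (markSum S ξ Y)) :=
    Measure.isProbabilityMeasure_map hm.aemeasurable
  have hmom : ∀ n : ℕ, ∫ x, x ^ n ∂(markIntensity lam S Y P)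
      = lam * ∑ y ∈ S, ∫ ω, Y y 0 ω ^ n ∂P := by
    intro n
    rw [integral_markIntensity hYm (by fun_prop) fun y => ?_]
    · simp only [NNReal.smul_def, smul_eq_mul, Finset.mul_sum]
    · have := hYm y 0
      refine Integrable.of_bound (by fun_prop) (B ^ n) (Eventually.of_forall fun ω => ?_)
      rw [Real.norm_of_nonneg (pow_nonneg (hY0 y 0 ω) n)]
      exact pow_le_pow_left₀ (hY0 y 0 ω) (hYB y 0 ω) n
  rw [← hmom] at h2 h3
  have hvar : Var[V; P] = M₂ := by
    rw [variance_congr hV, h2, ← h.variance_eq, variance_map (by fun_prop) hm.aemeasurable]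
    rfl
  refine ⟨?_, hvar ▸ hpos, ?_⟩
  · refine MemLp.ae_eq hV.symm ?_
    rw [memLp_two_iff_integrable_sq hm.aestronglyMeasurable]
    have := h.integrable_sq
    rwa [integrable_map_measure (by fun_prop) hm.aemeasurable] at this
  · have hlaw : P.map (standardize V P) = (P.map (markSum S ξ Y)).map
        (standardize (fun x => x) (P.map (markSum S ξ Y))) := by
      rw [Measure.map_map (by unfold standardize; fun_prop) hm]
      refine Measure.map_congr ?_
      filter_upwards [hV] with ω hω
      simp only [standardize, Function.comp_apply]
      rw [hvar, h2, ← h.variance_eq, hω, integral_congr_ae hV, integral_map hm.aemeasurable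
        (by fun_prop)]
    rw [hlaw, h2, h3]
    exact h.wassersteinDist_le (h2 ▸ hpos)

end MarkSum

/-! ### Moments of the number of visits, by recursion on the time -/

/-- The number of visits of the path `w` to `A` at the times `1, …, N`. -/
def visits (A : Finset ℤ) (N : ℕ) (w : ℕ → ℤ) : ℕ :=
  ((Finset.Icc 1 N).filter fun n => w n ∈ A).card

/-- The indicator of `A`, as a number of visits. -/
def visitInd (A : Finset ℤ) (z : ℤ) : ℕ := if z ∈ A then 1 else 0

theorem visits_zero (A : Finset ℤ) (w : ℕ → ℤ) : visits A 0 w = 0 := by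
  simp [visits]

theorem visits_succ (A : Finset ℤ) (N : ℕ) (w : ℕ → ℤ) :
    visits A (N + 1) w = visits A N w + visitInd A (w (N + 1)) := by
  unfold visits visitInd
  rw [← Finset.insert_Icc_right_eq_Icc_add_one (by lia), Finset.filter_insert]
  split_ifs with h
  · rw [Finset.card_insert_of_notMem (by simp)]
  · simp

theorem visits_le (A : Finset ℤ) (N : ℕ) (w : ℕ → ℤ) : visits A N w ≤ N :=
  (Finset.card_filter_le _ _).trans (by simp)

/-- The expectation of `φ (l + L)`, where `L` is the number of visits to `A` at the times
`1, …, n` of a simple random walk started from `y`. It is defined by recursion on the first step. -/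
noncomputable def visitExp (A : Finset ℤ) (φ : ℕ → ℝ≥0∞) : ℕ → ℤ → ℕ → ℝ≥0∞
  | 0, _, l => φ l
  | n + 1, y, l => 2⁻¹ * (visitExp A φ n (y + 1) (l + visitInd A (y + 1))
      + visitExp A φ n (y - 1) (l + visitInd A (y - 1)))

theorem visitExp_add_right (A : Finset ℤ) (φ : ℕ → ℝ≥0∞) (j n : ℕ) (y : ℤ) (l : ℕ) :
    visitExp A φ n y (l + j) = visitExp A (fun i => φ (i + j)) n y l := by
  induction n generalizing y l with
  | zero => rfl
  | succ n ih =>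
    simp only [visitExp]
    rw [← ih, ← ih, add_right_comm, add_right_comm l j]

theorem visitExp_add (A : Finset ℤ) (φ ψ : ℕ → ℝ≥0∞) (n : ℕ) (y : ℤ) (l : ℕ) :
    visitExp A (fun i => φ i + ψ i) n y l = visitExp A φ n y l + visitExp A ψ n y l := by
  induction n generalizing y l with
  | zero => rfl
  | succ n ih =>
    simp only [visitExp, ih]
    ring

theorem visitExp_const_mul (A : Finset ℤ) (c : ℝ≥0∞) (φ : ℕ → ℝ≥0∞) (n : ℕ) (y : ℤ) (l : ℕ) :
    visitExp A (fun i => c * φ i) n y l = c * visitExp A φ n y l := by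
  induction n generalizing y l with
  | zero => rfl
  | succ n ih =>
    simp only [visitExp, ih]
    ring

theorem inv_two_mul_add_self (c : ℝ≥0∞) : 2⁻¹ * (c + c) = c := by
  rw [← two_mul, ← mul_assoc, ENNReal.inv_mul_cancel (by simp) (by simp), one_mul]

theorem visitExp_const (A : Finset ℤ) (c : ℝ≥0∞) (n : ℕ) (y : ℤ) (l : ℕ) :
    visitExp A (fun _ => c) n y l = c := by
  induction n generalizing y l with
  | zero => rfl
  | succ n ih => simp only [visitExp, ih, inv_two_mul_add_self]

/-- The `k`-th moment of the number of visits to `A` at the times `1, …, n` of a simple random walk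
started from `y`. -/
noncomputable def visitMoment (A : Finset ℤ) (k n : ℕ) (y : ℤ) : ℝ≥0∞ :=
  visitExp A (fun i => (i : ℝ≥0∞) ^ k) n y 0

/-- The probability that a simple random walk started from `y` visits `A` at one of the times
`1, …, n`. -/
noncomputable def hitProb (A : Finset ℤ) (n : ℕ) (y : ℤ) : ℝ≥0∞ :=
  visitExp A (fun i => ((min i 1 : ℕ) : ℝ≥0∞)) n y 0

/-- The average over the two neighbours. -/
noncomputable def stepAvg (f : ℤ → ℝ≥0∞) (y : ℤ) : ℝ≥0∞ := 2⁻¹ * (f (y + 1) + f (y - 1))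

theorem stepAvg_mono {f g : ℤ → ℝ≥0∞} (h : ∀ z, f z ≤ g z) (y : ℤ) : stepAvg f y ≤ stepAvg g y := by
  unfold stepAvg
  gcongr <;> exact h _

theorem stepAvg_const_mul (c : ℝ≥0∞) (f : ℤ → ℝ≥0∞) (y : ℤ) :
    stepAvg (fun z => c * f z) y = c * stepAvg f y := by
  unfold stepAvg
  ring

theorem tsum_stepAvg (f : ℤ → ℝ≥0∞) : ∑' y, stepAvg f y = ∑' y, f y := by
  unfold stepAvg
  have h1 : ∑' y : ℤ, f (y + 1) = ∑' y, f y := (Equiv.addRight (1 : ℤ)).tsum_eq f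
  have h2 : ∑' y : ℤ, f (y - 1) = ∑' y, f y := (Equiv.subRight (1 : ℤ)).tsum_eq f
  rw [ENNReal.tsum_mul_left, ENNReal.tsum_add, h1, h2, inv_two_mul_add_self]

theorem visitExp_succ (A : Finset ℤ) (φ : ℕ → ℝ≥0∞) (n : ℕ) (y : ℤ) :
    visitExp A φ (n + 1) y 0
      = stepAvg (fun z => visitExp A (fun i => φ (i + visitInd A z)) n z 0) y := by
  simp only [visitExp, stepAvg, visitExp_add_right]

theorem visitMoment_one_succ (A : Finset ℤ) (n : ℕ) (y : ℤ) :
    visitMoment A 1 (n + 1) y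
      = stepAvg (fun z => visitMoment A 1 n z + if z ∈ A then 1 else 0) y := by
  rw [visitMoment, visitExp_succ]
  congr 1
  funext z
  by_cases hz : z ∈ A
  · simp only [visitInd, hz, if_true, pow_one, Nat.cast_add, Nat.cast_one, visitExp_add,
      visitExp_const, visitMoment]
  · simp [visitInd, hz, visitMoment]

theorem visitMoment_two_succ (A : Finset ℤ) (n : ℕ) (y : ℤ) :
    visitMoment A 2 (n + 1) y = stepAvg (fun z => visitMoment A 2 n z
      + if z ∈ A then 2 * visitMoment A 1 n z + 1 else 0) y := by
  rw [visitMoment, visitExp_succ]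
  congr 1
  funext z
  by_cases hz : z ∈ A
  · have h : ∀ i : ℕ, ((i + 1 : ℕ) : ℝ≥0∞) ^ 2 = (i : ℝ≥0∞) ^ 2 + (2 * (i : ℝ≥0∞) ^ 1 + 1) := by
      intro i
      push_cast
      ring
    simp only [visitInd, hz, if_true, h, visitExp_add, visitExp_const, visitExp_const_mul,
      visitMoment]
  · simp [visitInd, hz, visitMoment]

theorem visitMoment_three_succ (A : Finset ℤ) (n : ℕ) (y : ℤ) :
    visitMoment A 3 (n + 1) y = stepAvg (fun z => visitMoment A 3 n z
      + if z ∈ A then 3 * visitMoment A 2 n z + (3 * visitMoment A 1 n z + 1) else 0) y := by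
  rw [visitMoment, visitExp_succ]
  congr 1
  funext z
  by_cases hz : z ∈ A
  · have h : ∀ i : ℕ, ((i + 1 : ℕ) : ℝ≥0∞) ^ 3
        = (i : ℝ≥0∞) ^ 3 + (3 * (i : ℝ≥0∞) ^ 2 + (3 * (i : ℝ≥0∞) ^ 1 + 1)) := by
      intro i
      push_cast
      ring
    simp only [visitInd, hz, if_true, h, visitExp_add, visitExp_const, visitExp_const_mul,
      visitMoment]
  · simp [visitInd, hz, visitMoment]

theorem hitProb_succ (A : Finset ℤ) (n : ℕ) (y : ℤ) :
    hitProb A (n + 1) y = stepAvg (fun z => if z ∈ A then 1 else hitProb A n z) y := by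
  rw [hitProb, visitExp_succ]
  congr 1
  funext z
  by_cases hz : z ∈ A
  · simp [visitInd, hz, visitExp_const]
  · simp [visitInd, hz, hitProb]

theorem visitMoment_zero {A : Finset ℤ} {k : ℕ} (hk : k ≠ 0) (y : ℤ) : visitMoment A k 0 y = 0 := by
  simp [visitMoment, visitExp, hk]

/-- The walk makes unit steps, so it cannot reach `A` from a distance greater than `n`. -/
theorem visitMoment_one_eq_zero {A : Finset ℤ} {n : ℕ} {y : ℤ} (h : ∀ a ∈ A, (n : ℤ) < |y - a|) :
    visitMoment A 1 n y = 0 := by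
  induction n generalizing y with
  | zero => exact visitMoment_zero one_ne_zero y
  | succ n ih =>
    have key : ∀ z : ℤ, |z - y| ≤ 1 → visitMoment A 1 n z + (if z ∈ A then 1 else 0) = 0 := by
      intro z hz
      have h1 : ∀ a ∈ A, (n : ℤ) < |z - a| := fun a ha => by
        have h2 := h a ha
        push_cast at h2
        have h3 := abs_sub_le y z a
        rw [abs_sub_comm y z] at h3
        linarith
      have h2 : z ∉ A := fun hzA => by
        have := h1 z hzA
        rw [sub_self, abs_zero] at this
        lia
      rw [ih h1, if_neg h2, add_zero]
    rw [visitMoment_one_succ, stepAvg, key _ (by simp), key _ (by simp)]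
    simp

theorem tsum_ite_mem (A : Finset ℤ) (f : ℤ → ℝ≥0∞) :
    ∑' z, (if z ∈ A then f z else 0) = ∑ z ∈ A, f z := by
  rw [tsum_eq_sum (s := A) fun z hz => if_neg hz]
  exact Finset.sum_congr rfl fun z hz => if_pos hz

theorem tsum_visitMoment_one (A : Finset ℤ) (n : ℕ) :
    ∑' y, visitMoment A 1 n y = A.card * n := by
  induction n with
  | zero => simp [visitMoment_zero]
  | succ n ih =>
    simp_rw [visitMoment_one_succ]
    rw [tsum_stepAvg, ENNReal.tsum_add, ih, tsum_ite_mem]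
    simp
    ring

theorem tsum_visitMoment_two (A : Finset ℤ) (n : ℕ) :
    ∑' y, visitMoment A 2 n y
      = ∑ m ∈ Finset.range n, ∑ z ∈ A, (2 * visitMoment A 1 m z + 1) := by
  induction n with
  | zero => simp [visitMoment_zero]
  | succ n ih =>
    simp_rw [visitMoment_two_succ]
    rw [tsum_stepAvg, ENNReal.tsum_add, ih, tsum_ite_mem, Finset.sum_range_succ]

theorem tsum_visitMoment_three (A : Finset ℤ) (n : ℕ) :
    ∑' y, visitMoment A 3 n y = ∑ m ∈ Finset.range n, ∑ z ∈ A,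
      (3 * visitMoment A 2 m z + (3 * visitMoment A 1 m z + 1)) := by
  induction n with
  | zero => simp [visitMoment_zero]
  | succ n ih =>
    simp_rw [visitMoment_three_succ]
    rw [tsum_stepAvg, ENNReal.tsum_add, ih, tsum_ite_mem, Finset.sum_range_succ]

/-- A uniform bound on the expected number of visits controls the second moment, since after each
visit the walk starts afresh. -/
theorem visitMoment_two_le {A : Finset ℤ} {K : ℝ≥0∞} {N : ℕ}
    (hK : ∀ n ≤ N, ∀ y, visitMoment A 1 n y ≤ K) {n : ℕ} (hn : n ≤ N) (y : ℤ) :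
    visitMoment A 2 n y ≤ (2 * K + 1) * visitMoment A 1 n y := by
  induction n generalizing y with
  | zero => simp [visitMoment_zero]
  | succ n ih =>
    rw [visitMoment_two_succ, visitMoment_one_succ, ← stepAvg_const_mul]
    refine stepAvg_mono (fun z => ?_) y
    rw [mul_add]
    have h1 := ih (by lia) z
    have h2 := hK n (by lia) z
    split_ifs
    · rw [mul_one]
      gcongr
    · simpa using h1

/-- Once `A` is hit, at most `K` further visits are expected: a lower bound on the probability of
hitting `A`. -/
theorem visitMoment_one_le_hitProb {A : Finset ℤ} {K : ℝ≥0∞} {N : ℕ}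
    (hK : ∀ n ≤ N, ∀ y, visitMoment A 1 n y ≤ K) {n : ℕ} (hn : n ≤ N) (y : ℤ) :
    visitMoment A 1 n y ≤ (K + 1) * hitProb A n y := by
  induction n generalizing y with
  | zero => simp [visitMoment_zero]
  | succ n ih =>
    rw [visitMoment_one_succ, hitProb_succ, ← stepAvg_const_mul]
    refine stepAvg_mono (fun z => ?_) y
    split_ifs
    · rw [mul_one]
      gcongr
      exact hK n (by lia) z
    · simpa using ih (by lia) z

/-! ### The expected local time at a point -/

/-- The expected number of visits to `0` at the times `1, …, n` of a simple random walk started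
from `y`. -/
noncomputable def localTime : ℕ → ℤ → ℝ
  | 0, _ => 0
  | n + 1, y => (localTime n (y + 1) + (if y + 1 = 0 then 1 else 0)
      + (localTime n (y - 1) + if y - 1 = 0 then 1 else 0)) / 2

theorem localTime_nonneg (n : ℕ) (y : ℤ) : 0 ≤ localTime n y := by
  induction n generalizing y with
  | zero => exact le_rfl
  | succ n ih =>
    have h1 := ih (y + 1)
    have h2 := ih (y - 1)
    simp only [localTime]
    positivity

theorem visitMoment_one_eq (A : Finset ℤ) (n : ℕ) (y : ℤ) :
    visitMoment A 1 n y = ENNReal.ofReal (∑ a ∈ A, localTime n (y - a)) := by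
  induction n generalizing y with
  | zero => simp [visitMoment_zero, localTime]
  | succ n ih =>
    have key : ∀ z, visitMoment A 1 n z + (if z ∈ A then 1 else 0)
        = ENNReal.ofReal (∑ a ∈ A, (localTime n (z - a) + if z - a = 0 then 1 else 0)) := by
      intro z
      rw [Finset.sum_add_distrib, ENNReal.ofReal_add
        (Finset.sum_nonneg fun a _ => localTime_nonneg _ _)
        (Finset.sum_nonneg fun a _ => by positivity), ih]
      congr 1
      simp only [sub_eq_zero, Finset.sum_ite_eq]
      split_ifs <;> simp
    have hnn : ∀ z, 0 ≤ ∑ a ∈ A, (localTime n (z - a) + if z - a = 0 then 1 else 0) := fun z =>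
      Finset.sum_nonneg fun a _ => add_nonneg (localTime_nonneg _ _) (by positivity)
    rw [visitMoment_one_succ, stepAvg, key, key, ← ENNReal.ofReal_add (hnn _) (hnn _)]
    have h2 : (2⁻¹ : ℝ≥0∞) = ENNReal.ofReal 2⁻¹ := by
      rw [ENNReal.ofReal_inv_of_pos two_pos]
      simp
    rw [h2, ← ENNReal.ofReal_mul (by norm_num), ← Finset.sum_add_distrib, Finset.mul_sum]
    congr 1
    refine Finset.sum_congr rfl fun a _ => ?_
    simp only [localTime]
    rw [show y + 1 - a = y - a + 1 by ring, show y - 1 - a = y - a - 1 by ring]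
    ring

theorem abs_add_one_add_abs_sub_one (y : ℤ) :
    (|((y + 1 : ℤ) : ℝ)| + |((y - 1 : ℤ) : ℝ)|) / 2 = |(y : ℝ)| + if y = 0 then 1 else 0 := by
  have h : |y + 1| + |y - 1| = 2 * (|y| + if y = 0 then 1 else 0) := by
    split_ifs with h0
    · simp [h0]
    · rcases lt_or_gt_of_ne h0 with h | h
      · rw [abs_of_nonpos (by lia), abs_of_nonpos (by lia), abs_of_neg h]
        ring
      · rw [abs_of_nonneg (by lia), abs_of_nonneg (by lia), abs_of_pos h]
        ring
  have h2 : ((|y + 1| + |y - 1| : ℤ) : ℝ) = ((2 * (|y| + if y = 0 then 1 else 0) : ℤ) : ℝ) := by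
    rw [h]
  push_cast at h2 ⊢
  linarith

/-- By the discrete Tanaka formula, the local time is the increment of `𝔼 |X_n|`, up to boundary
terms, and `𝔼 |X_n| ≤ √(y² + n)`. -/
theorem localTime_le (n : ℕ) (y : ℤ) :
    localTime n y ≤ √((y : ℝ) ^ 2 + n) - |(y : ℝ)| - (if y = 0 then 1 else 0) + 1 := by
  induction n generalizing y with
  | zero =>
    simp only [localTime, Nat.cast_zero, add_zero, Real.sqrt_sq_eq_abs]
    split_ifs <;> simp
  | succ n ih =>
    have h1 := ih (y + 1)
    have h2 := ih (y - 1)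
    have h3 := abs_add_one_add_abs_sub_one y
    have h4 : √(((y + 1 : ℤ) : ℝ) ^ 2 + n) + √(((y - 1 : ℤ) : ℝ) ^ 2 + n)
        ≤ 2 * √((y : ℝ) ^ 2 + (n + 1 : ℕ)) := by
      push_cast
      set p : ℝ := ((y : ℝ) + 1) ^ 2 + n with hp
      set q : ℝ := ((y : ℝ) - 1) ^ 2 + n with hq
      have hp0 : 0 ≤ p := by positivity
      have hq0 : 0 ≤ q := by positivity
      have hpq : (y : ℝ) ^ 2 + (n + 1) = (p + q) / 2 := by
        rw [hp, hq]
        ring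
      rw [hpq]
      refine (pow_le_pow_iff_left₀ (by positivity) (by positivity) two_ne_zero).1 ?_
      rw [mul_pow, Real.sq_sqrt (by positivity)]
      nlinarith [sq_nonneg (√p - √q), Real.sq_sqrt hp0, Real.sq_sqrt hq0]
    simp only [localTime]
    linarith

theorem localTime_le_sqrt (n : ℕ) (y : ℤ) : localTime n y ≤ √n + 1 := by
  refine (localTime_le n y).trans ?_
  have h1 : √((y : ℝ) ^ 2 + n) ≤ |(y : ℝ)| + √n := by
    refine Real.sqrt_le_iff.2 ⟨by positivity, ?_⟩
    have h2 : √(n : ℝ) ^ 2 = n := Real.sq_sqrt (Nat.cast_nonneg n)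
    have h3 : 0 ≤ |(y : ℝ)| * √n := by positivity
    nlinarith [sq_abs (y : ℝ)]
  have h2 : (0 : ℝ) ≤ if y = 0 then 1 else 0 := by positivity
  linarith

/-- A lower bound on the local time by the discrete Tanaka formula, from `|x| ≥ s (u² - u⁴)` with
`u = x / (3 s)` and the second and fourth moments of the walk. -/
theorem le_localTime {s : ℝ} (hs : 0 < s) (n : ℕ) (y : ℤ) :
    ((y : ℝ) ^ 2 + n) / (9 * s)
        - ((y : ℝ) ^ 4 + 6 * n * (y : ℝ) ^ 2 + 3 * (n : ℝ) ^ 2 - 2 * n) / (81 * s ^ 3)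
        - |(y : ℝ)| - (if y = 0 then 1 else 0) ≤ localTime n y := by
  induction n generalizing y with
  | zero =>
    have h0 : (0 : ℝ) ≤ if y = 0 then 1 else 0 := by positivity
    have h1 : (y : ℝ) ^ 2 / (9 * s) - (y : ℝ) ^ 4 / (81 * s ^ 3) ≤ |(y : ℝ)| := by
      have h2 : ∀ a : ℝ, 0 ≤ a → a ^ 2 / (9 * s) - a ^ 4 / (81 * s ^ 3) ≤ a := by
        intro a ha
        have h3 : a ^ 2 / (9 * s) - a ^ 4 / (81 * s ^ 3)
            = a * (a / (9 * s) - a ^ 3 / (81 * s ^ 3)) := by ring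
        rw [h3]
        refine mul_le_of_le_one_right ha ?_
        set v := a / (9 * s) with hv
        have hv0 : 0 ≤ v := by positivity
        have h4 : a ^ 3 / (81 * s ^ 3) = 9 * v ^ 3 := by
          rw [hv]
          field_simp
          norm_num
        rw [h4]
        nlinarith [mul_nonneg hv0 (sq_nonneg (v - 1)), mul_nonneg hv0 (sq_nonneg v),
          mul_nonneg hv0 hv0, sq_nonneg (v - 1)]
      have := h2 |(y : ℝ)| (abs_nonneg _)
      have h5 : |(y : ℝ)| ^ 4 = (y : ℝ) ^ 4 := by
        rw [pow_abs, abs_of_nonneg (by positivity)]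
      rwa [sq_abs, h5] at this
    simp only [localTime, Nat.cast_zero]
    ring_nf at h1 ⊢
    linarith
  | succ n ih =>
    have h1 := ih (y + 1)
    have h2 := ih (y - 1)
    have h3 := abs_add_one_add_abs_sub_one y
    simp only [localTime]
    refine le_trans (le_of_eq ?_)
      (by linarith : ((((y + 1 : ℤ) : ℝ) ^ 2 + n) / (9 * s)
        - (((y + 1 : ℤ) : ℝ) ^ 4 + 6 * n * ((y + 1 : ℤ) : ℝ) ^ 2 + 3 * (n : ℝ) ^ 2 - 2 * n)
          / (81 * s ^ 3) - |((y + 1 : ℤ) : ℝ)|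
        + ((((y - 1 : ℤ) : ℝ) ^ 2 + n) / (9 * s)
        - (((y - 1 : ℤ) : ℝ) ^ 4 + 6 * n * ((y - 1 : ℤ) : ℝ) ^ 2 + 3 * (n : ℝ) ^ 2 - 2 * n)
          / (81 * s ^ 3) - |((y - 1 : ℤ) : ℝ)|)) / 2 ≤ _)
    rw [sub_sub _ |(y : ℝ)|, ← h3]
    push_cast
    ring

/-- The local time at the starting point is at least of order `√n`. The parameter `s = √n` is the
right scale in `le_localTime`; the bound is trivial for small `n`. -/
theorem le_localTime_zero (n : ℕ) : (√(n + 1 : ℕ) : ℝ) / 27 ≤ 2 * localTime n 0 + 1 := by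
  have h0 := localTime_nonneg n 0
  have h1 : √((n + 1 : ℕ) : ℝ) ≤ √n + 1 := by
    refine Real.sqrt_le_iff.2 ⟨by positivity, ?_⟩
    have h2 : √(n : ℝ) ^ 2 = n := Real.sq_sqrt (Nat.cast_nonneg n)
    push_cast
    nlinarith [Real.sqrt_nonneg (n : ℝ)]
  have h2 : 2 * √(n : ℝ) / 27 - 1 ≤ localTime n 0 := by
    rcases Nat.eq_zero_or_pos n with rfl | hn
    · simp [localTime]
    · have hs : (0 : ℝ) < √n := Real.sqrt_pos.2 (by exact_mod_cast hn)
      have h3 := le_localTime hs n 0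
      have h4 : (√(n : ℝ)) ^ 2 = n := Real.sq_sqrt (Nat.cast_nonneg n)
      refine le_trans ?_ h3
      set s := √(n : ℝ)
      rw [← h4]
      simp only [Int.cast_zero, abs_zero, if_true]
      have h5 : (0 ^ 2 + s ^ 2) / (9 * s)
          - (0 ^ 4 + 6 * s ^ 2 * 0 ^ 2 + 3 * (s ^ 2) ^ 2 - 2 * s ^ 2) / (81 * s ^ 3) - 0 - 1
          = 2 * s / 27 - 1 + 2 / (81 * s) := by
        field_simp
        ring
      rw [h5]
      have : 0 < 2 / (81 * s) := by positivity
      linarith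
  linarith

/-! ### Growth of the moments, summed over the starting points -/

theorem visitMoment_one_le {A : Finset ℤ} {n N : ℕ} (hn : n ≤ N) (hN : 1 ≤ N) (y : ℤ) :
    visitMoment A 1 n y ≤ ENNReal.ofReal (2 * A.card * √N) := by
  rw [visitMoment_one_eq]
  refine ENNReal.ofReal_le_ofReal ?_
  have h1 : (1 : ℝ) ≤ √N := Real.one_le_sqrt.2 (by exact_mod_cast hN)
  have h2 : √(n : ℝ) ≤ √N := Real.sqrt_le_sqrt (by exact_mod_cast hn)
  refine (Finset.sum_le_card_nsmul A _ (2 * √N) fun a _ => ?_).trans_eq ?_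
  · exact (localTime_le_sqrt n (y - a)).trans (by linarith)
  · rw [nsmul_eq_mul]
    ring

/-- With the bound `K = 2 |A| √N` on the first moments, each term of `tsum_visitMoment_three` is at
most `3 (2 K + 1) K + 3 K + 1 ≤ 10 K²`. -/
theorem tsum_visitMoment_three_le {A : Finset ℤ} (hA : A.Nonempty) {N : ℕ} (hN : 1 ≤ N) :
    ∑' y, visitMoment A 3 N y ≤ ENNReal.ofReal (40 * A.card ^ 3 * (N : ℝ) ^ 2) := by
  have hc : (1 : ℝ) ≤ A.card := by exact_mod_cast hA.card_pos
  have hs : (1 : ℝ) ≤ √N := Real.one_le_sqrt.2 (by exact_mod_cast hN)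
  obtain ⟨K, hK⟩ : ∃ K : ℝ, K = 2 * A.card * √N := ⟨_, rfl⟩
  have hK2 : 2 ≤ K := by rw [hK]; nlinarith
  have hb : ∀ n ≤ N, ∀ y, visitMoment A 1 n y ≤ ENNReal.ofReal K := fun n hn y =>
    hK ▸ visitMoment_one_le hn hN y
  have hK1 : 2 * ENNReal.ofReal K + 1 = ENNReal.ofReal (2 * K + 1) := by
    rw [ENNReal.ofReal_add (by linarith) zero_le_one, ENNReal.ofReal_mul zero_le_two]
    simp
  rw [tsum_visitMoment_three]
  have hterm : ∀ m ∈ Finset.range N, ∀ z ∈ A,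
      3 * visitMoment A 2 m z + (3 * visitMoment A 1 m z + 1) ≤ ENNReal.ofReal (10 * K ^ 2) := by
    intro m hm z _
    have hm : m ≤ N := (Finset.mem_range.1 hm).le
    have h1 := hb m hm z
    have h2 : visitMoment A 2 m z ≤ ENNReal.ofReal ((2 * K + 1) * K) := by
      refine (visitMoment_two_le hb hm z).trans ?_
      rw [hK1, ENNReal.ofReal_mul (by linarith)]
      gcongr
    calc 3 * visitMoment A 2 m z + (3 * visitMoment A 1 m z + 1)
        ≤ 3 * ENNReal.ofReal ((2 * K + 1) * K) + (3 * ENNReal.ofReal K + 1) := by gcongr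
      _ = ENNReal.ofReal (3 * ((2 * K + 1) * K) + (3 * K + 1)) := by
        rw [ENNReal.ofReal_add (by positivity) (by positivity),
          ENNReal.ofReal_add (by positivity) zero_le_one,
          ENNReal.ofReal_mul (p := 3) (q := (2 * K + 1) * K) (by positivity),
          ENNReal.ofReal_mul (p := 3) (q := K) (by positivity)]
        simp
      _ ≤ ENNReal.ofReal (10 * K ^ 2) := ENNReal.ofReal_le_ofReal (by nlinarith)
  refine (Finset.sum_le_sum fun m hm => Finset.sum_le_sum fun z hz => hterm m hm z hz).trans ?_
  rw [Finset.sum_const, Finset.sum_const, Finset.card_range, nsmul_eq_mul, nsmul_eq_mul,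
    ← ENNReal.ofReal_natCast, ← ENNReal.ofReal_natCast, ← ENNReal.ofReal_mul (by positivity),
    ← ENNReal.ofReal_mul (by positivity)]
  refine ENNReal.ofReal_le_ofReal (le_of_eq ?_)
  have : √(N : ℝ) ^ 2 = N := Real.sq_sqrt (Nat.cast_nonneg N)
  rw [hK]
  linear_combination (40 * A.card ^ 3 * N : ℝ) * this

theorem le_tsum_visitMoment_two {A : Finset ℤ} (hA : A.Nonempty) {N : ℕ} (hN : 1 ≤ N) :
    ENNReal.ofReal (N * √N / 54) ≤ ∑' y, visitMoment A 2 N y := by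
  obtain ⟨a, ha⟩ := hA
  have hs : 0 < √(N : ℝ) := Real.sqrt_pos.2 (by exact_mod_cast hN)
  have hs2 : √(N : ℝ) ^ 2 = N := Real.sq_sqrt (Nat.cast_nonneg N)
  rw [tsum_visitMoment_two]
  have hterm : ∀ m ∈ Finset.range N, ENNReal.ofReal ((m + 1 : ℕ) / (27 * √N))
      ≤ ∑ z ∈ A, (2 * visitMoment A 1 m z + 1) := by
    intro m hm
    have hm1 : m + 1 ≤ N := Finset.mem_range.1 hm
    refine le_trans ?_ (Finset.single_le_sum (fun _ _ => zero_le) ha)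
    have h1 : ENNReal.ofReal (localTime m 0) ≤ visitMoment A 1 m a := by
      rw [visitMoment_one_eq]
      refine ENNReal.ofReal_le_ofReal ?_
      have := Finset.single_le_sum (f := fun b => localTime m (a - b))
        (fun b _ => localTime_nonneg _ _) ha
      simpa using this
    calc ENNReal.ofReal ((m + 1 : ℕ) / (27 * √N))
        ≤ ENNReal.ofReal (2 * localTime m 0 + 1) := by
          refine ENNReal.ofReal_le_ofReal (le_trans ?_ (le_localTime_zero m))
          have h2 : √((m + 1 : ℕ) : ℝ) ≤ √N := Real.sqrt_le_sqrt (by exact_mod_cast hm1)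
          have h3 : √((m + 1 : ℕ) : ℝ) ^ 2 = (m + 1 : ℕ) := Real.sq_sqrt (Nat.cast_nonneg _)
          rw [div_le_div_iff₀ (by positivity) (by norm_num)]
          nlinarith [Real.sqrt_nonneg ((m + 1 : ℕ) : ℝ)]
      _ = 2 * ENNReal.ofReal (localTime m 0) + 1 := by
          rw [ENNReal.ofReal_add (mul_nonneg zero_le_two (localTime_nonneg _ _)) zero_le_one,
            ENNReal.ofReal_mul zero_le_two]
          simp
      _ ≤ _ := by gcongr
  refine le_trans ?_ (Finset.sum_le_sum hterm)
  rw [← ENNReal.ofReal_sum_of_nonneg fun m _ => by positivity]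
  refine ENNReal.ofReal_le_ofReal ?_
  rw [← Finset.sum_div]
  have hg : ∑ m ∈ Finset.range N, ((m + 1 : ℕ) : ℝ) = N * (N + 1) / 2 := by
    clear hterm hs hs2 hN
    induction N with
    | zero => simp
    | succ N ih =>
      rw [Finset.sum_range_succ, ih]
      push_cast
      ring
  rw [hg, le_div_iff₀ (by positivity)]
  have : (0 : ℝ) ≤ N := Nat.cast_nonneg N
  nlinarith

theorem le_tsum_hitProb {A : Finset ℤ} (hA : A.Nonempty) {N : ℕ} (hN : 1 ≤ N) :
    ENNReal.ofReal (√N / 4) ≤ ∑' y, hitProb A N y := by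
  have hc : (1 : ℝ) ≤ A.card := by exact_mod_cast hA.card_pos
  have hs : (1 : ℝ) ≤ √N := Real.one_le_sqrt.2 (by exact_mod_cast hN)
  have hs2 : √(N : ℝ) ^ 2 = N := Real.sq_sqrt (Nat.cast_nonneg N)
  have hb : ∀ n ≤ N, ∀ y, visitMoment A 1 n y ≤ ENNReal.ofReal (2 * A.card * √N) := fun n hn y =>
    visitMoment_one_le hn hN y
  have h1 : (A.card * N : ℝ≥0∞) ≤ ENNReal.ofReal (4 * A.card * √N) * ∑' y, hitProb A N y := by
    rw [← tsum_visitMoment_one, ← ENNReal.tsum_mul_left]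
    refine ENNReal.tsum_le_tsum fun y => (visitMoment_one_le_hitProb hb le_rfl y).trans ?_
    gcongr
    rw [← ENNReal.ofReal_one, ← ENNReal.ofReal_add (by positivity) zero_le_one]
    exact ENNReal.ofReal_le_ofReal (by nlinarith)
  have hpos : 0 < 4 * A.card * √(N : ℝ) := by positivity
  have h2 : (A.card * N : ℝ≥0∞) = ENNReal.ofReal (4 * A.card * √N) * ENNReal.ofReal (√N / 4) := by
    rw [← ENNReal.ofReal_mul hpos.le, ← ENNReal.ofReal_natCast, ← ENNReal.ofReal_natCast,
      ← ENNReal.ofReal_mul (by positivity)]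
    congr 1
    linear_combination -(A.card : ℝ) * hs2
  rw [h2] at h1
  exact (ENNReal.mul_le_mul_iff_right (ENNReal.ofReal_pos.2 hpos).ne' ENNReal.ofReal_ne_top).1 h1

/-! ### The number of visits of a simple random walk -/

section Walk

variable {Ω : Type*} [MeasurableSpace Ω] {P : Measure Ω}

theorem measurable_visits (A : Finset ℤ) (N : ℕ) : Measurable (visits A N) := by
  induction N with
  | zero =>
    have h : visits A 0 = fun _ => 0 := funext fun w => visits_zero A w
    rw [h]
    exact measurable_const
  | succ N ih =>
    have h : visits A (N + 1) = fun w => visits A N w + visitInd A (w (N + 1)) :=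
      funext fun w => visits_succ A N w
    rw [h]
    have h2 : Measurable (visitInd A) := measurable_of_countable _
    exact ih.add (h2.comp (measurable_pi_apply (N + 1)))

theorem visits_congr {A : Finset ℤ} {n : ℕ} {w w' : ℕ → ℤ} (h : ∀ m ≤ n, w m = w' m) :
    visits A n w = visits A n w' := by
  unfold visits
  congr 1
  refine Finset.filter_congr fun m hm => ?_
  rw [h m (Finset.mem_Icc.1 hm).2]

theorem IsSimpleRandomWalk.ae_eq_walkOfSteps {S : ℕ → Ω → ℤ} {y : ℤ}
    (h : IsSimpleRandomWalk S y P) :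
    ∀ᵐ ω ∂P, ∀ n, S n ω = walkOfSteps y (fun k => S (k + 1) ω - S k ω) n := by
  filter_upwards [h.start] with ω hω n
  rw [walkOfSteps, Finset.sum_range_sub fun k => S k ω, hω]
  ring

theorem IsSimpleRandomWalk.ae_step [IsProbabilityMeasure P] {S : ℕ → Ω → ℤ} {y : ℤ}
    (h : IsSimpleRandomWalk S y P) (n : ℕ) :
    ∀ᵐ ω ∂P, S (n + 1) ω - S n ω = 1 ∨ S (n + 1) ω - S n ω = -1 := by
  have hT : Measurable fun ω => S (n + 1) ω - S n ω := (h.measurable _).sub (h.measurable _)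
  have h1 : MeasurableSet {ω | S (n + 1) ω - S n ω = 1} := hT (measurableSet_singleton 1)
  have h2 : MeasurableSet {ω | S (n + 1) ω - S n ω = -1} := hT (measurableSet_singleton (-1))
  have h3 : P ({ω | S (n + 1) ω - S n ω = 1} ∪ {ω | S (n + 1) ω - S n ω = -1}) = 1 := by
    rw [measure_union _ h2, h.step_up, h.step_down, ENNReal.add_halves]
    refine Set.disjoint_left.2 fun ω hω hω' => ?_
    have := hω.symm.trans hω'
    lia
  exact (prob_compl_eq_zero_iff (h1.union h2)).2 h3

/-- The next step is independent of the position and of the number of visits so far. -/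
theorem IsSimpleRandomWalk.indepFun_step [IsProbabilityMeasure P] {S : ℕ → Ω → ℤ} {y : ℤ}
    (h : IsSimpleRandomWalk S y P) (A : Finset ℤ) (n : ℕ) :
    IndepFun (fun ω => S (n + 1) ω - S n ω) (fun ω => (S n ω, visits A n fun m => S m ω)) P := by
  have h1 := h.indep_steps.indepFun_finset {n} (Finset.range n) (by simp)
    (fun k => (h.measurable _).sub (h.measurable _))
  set w : (Finset.range n → ℤ) → ℕ → ℤ := fun v =>
    walkOfSteps y fun k => if hk : k ∈ Finset.range n then v ⟨k, hk⟩ else 0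
  have h2 := h1.comp (φ := fun v => v ⟨n, by simp⟩) (ψ := fun v => (w v n, visits A n (w v)))
    (measurable_of_countable _) (measurable_of_countable _)
  refine h2.congr (Eventually.of_forall fun ω => rfl) ?_
  filter_upwards [h.ae_eq_walkOfSteps] with ω hω
  have h3 : ∀ m ≤ n, w (fun k => S (k + 1) ω - S k ω) m = S m ω := by
    intro m hm
    rw [hω m]
    simp only [w, walkOfSteps]
    congr 1
    refine Finset.sum_congr rfl fun k hk => ?_
    rw [dif_pos (Finset.mem_range.2 ((Finset.mem_range.1 hk).trans_le hm))]
  simp only [Function.comp_apply]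
  exact Prod.ext (h3 n le_rfl) (visits_congr h3)

theorem IsSimpleRandomWalk.measurable_path {S : ℕ → Ω → ℤ} {y : ℤ}
    (h : IsSimpleRandomWalk S y P) : Measurable fun ω n => S n ω :=
  measurable_pi_lambda _ h.measurable

/-- The Markov property of the position together with the number of visits. -/
theorem IsSimpleRandomWalk.lintegral_succ [IsProbabilityMeasure P] {S : ℕ → Ω → ℤ} {y : ℤ}
    (h : IsSimpleRandomWalk S y P) (A : Finset ℤ) (n : ℕ) (ψ : ℤ → ℕ → ℝ≥0∞) :
    ∫⁻ ω, ψ (S (n + 1) ω) (visits A (n + 1) fun m => S m ω) ∂P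
      = ∫⁻ ω, 2⁻¹ * (ψ (S n ω + 1) ((visits A n fun m => S m ω) + visitInd A (S n ω + 1))
        + ψ (S n ω - 1) ((visits A n fun m => S m ω) + visitInd A (S n ω - 1))) ∂P := by
  have hT : Measurable fun ω => S (n + 1) ω - S n ω := (h.measurable _).sub (h.measurable _)
  have hL : Measurable fun ω => (S n ω, visits A n fun m => S m ω) :=
    (h.measurable n).prodMk ((measurable_visits A n).comp h.measurable_path)
  have key : ∀ c : ℤ, P {ω | S (n + 1) ω - S n ω = c} = 1 / 2 → ∀ G : ℤ × ℕ → ℝ≥0∞,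
      ∫⁻ ω, (if S (n + 1) ω - S n ω = c then 1 else 0) * G (S n ω, visits A n fun m => S m ω) ∂P
        = 2⁻¹ * ∫⁻ ω, G (S n ω, visits A n fun m => S m ω) ∂P := by
    intro c hc G
    have hi : Measurable fun k : ℤ => if k = c then (1 : ℝ≥0∞) else 0 := measurable_of_countable _
    have hG : Measurable G := measurable_of_countable _
    have h1 := lintegral_mul_eq_lintegral_mul_lintegral_of_indepFun (hi.comp hT) (hG.comp hL)
      ((h.indepFun_step A n).comp hi hG)
    refine h1.trans ?_
    congr 1
    have h2 := lintegral_indicator_one (μ := P) (hT (measurableSet_singleton c))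
    rw [← one_div, ← hc]
    refine Eq.trans (lintegral_congr fun ω => ?_) h2
    simp only [Function.comp_apply]
    by_cases hω : S (n + 1) ω - S n ω = c
    · rw [if_pos hω, Set.indicator_of_mem (by exact hω), Pi.one_apply]
    · rw [if_neg hω, Set.indicator_of_notMem (by exact hω)]
  set G₁ : ℤ × ℕ → ℝ≥0∞ := fun q => ψ (q.1 + 1) (q.2 + visitInd A (q.1 + 1)) with hG₁
  set G₂ : ℤ × ℕ → ℝ≥0∞ := fun q => ψ (q.1 - 1) (q.2 + visitInd A (q.1 - 1)) with hG₂
  have hm : ∀ G : ℤ × ℕ → ℝ≥0∞, Measurable fun ω => G (S n ω, visits A n fun m => S m ω) :=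
    fun G => (measurable_of_countable G).comp hL
  have hi : Measurable fun ω => if S (n + 1) ω - S n ω = 1 then (1 : ℝ≥0∞) else 0 :=
    (measurable_of_countable fun k : ℤ => if k = 1 then (1 : ℝ≥0∞) else 0).comp hT
  calc ∫⁻ ω, ψ (S (n + 1) ω) (visits A (n + 1) fun m => S m ω) ∂P
      = ∫⁻ ω, ((if S (n + 1) ω - S n ω = 1 then 1 else 0) * G₁ (S n ω, visits A n fun m => S m ω)
        + (if S (n + 1) ω - S n ω = -1 then 1 else 0)
          * G₂ (S n ω, visits A n fun m => S m ω)) ∂P := by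
        refine lintegral_congr_ae ?_
        filter_upwards [h.ae_step n] with ω hω
        rw [visits_succ]
        rcases hω with hω | hω
        · have h1 : S (n + 1) ω = S n ω + 1 := by lia
          simp [h1, hG₁]
        · have h1 : S (n + 1) ω = S n ω - 1 := by lia
          simp [h1, hG₂]
    _ = _ := by
        have hi' : Measurable fun ω => (if S (n + 1) ω - S n ω = 1 then 1 else 0)
            * G₁ (S n ω, visits A n fun m => S m ω) := hi.mul (hm G₁)
        rw [lintegral_add_left hi', key 1 (h.step_up n), key (-1) (h.step_down n),
          ← mul_add, ← lintegral_add_left (hm G₁)]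
        exact (lintegral_const_mul _ ((hm G₁).add (hm G₂))).symm

/-- The recursively defined `visitExp` is the expectation it stands for: apply the Markov property
to one more step at a time. -/
theorem IsSimpleRandomWalk.lintegral_visits [IsProbabilityMeasure P] {S : ℕ → Ω → ℤ} {y : ℤ}
    (h : IsSimpleRandomWalk S y P) (A : Finset ℤ) (N : ℕ) (φ : ℕ → ℝ≥0∞) :
    ∫⁻ ω, φ (visits A N fun m => S m ω) ∂P = visitExp A φ N y 0 := by
  have key : ∀ k n, ∫⁻ ω, visitExp A φ k (S n ω) (visits A n fun m => S m ω) ∂P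
      = ∫⁻ ω, φ (visits A (n + k) fun m => S m ω) ∂P := by
    intro k
    induction k with
    | zero => intro n; rfl
    | succ k ih =>
      intro n
      rw [show n + (k + 1) = n + 1 + k by ring, ← ih (n + 1), h.lintegral_succ]
      rfl
  rw [← zero_add N, ← key N 0, zero_add]
  have h1 : ∀ᵐ ω ∂P, visitExp A φ N (S 0 ω) (visits A 0 fun m => S m ω)
      = visitExp A φ N y 0 := by
    filter_upwards [h.start] with ω hω
    rw [hω, visits_zero]
  rw [lintegral_congr_ae h1]
  simp

theorem IsSimpleRandomWalk.map_visits_eq {Ω' : Type*} [MeasurableSpace Ω'] {P' : Measure Ω'}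
    [IsProbabilityMeasure P] [IsProbabilityMeasure P'] {S : ℕ → Ω → ℤ} {S' : ℕ → Ω' → ℤ} {y : ℤ}
    (h : IsSimpleRandomWalk S y P) (h' : IsSimpleRandomWalk S' y P') (A : Finset ℤ) (N : ℕ) :
    P.map (fun ω => visits A N fun m => S m ω) = P'.map fun ω => visits A N fun m => S' m ω := by
  have hm := (measurable_visits A N).comp h.measurable_path
  have hm' := (measurable_visits A N).comp h'.measurable_path
  refine Measure.ext_of_lintegral _ fun φ hφ => ?_
  refine (lintegral_map hφ hm).trans (Eq.trans ?_ (lintegral_map hφ hm').symm)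
  exact (h.lintegral_visits A N φ).trans (h'.lintegral_visits A N φ).symm

end Walk

/-! ### The cumulative occupation and the number of visitors as Poisson sums -/

theorem sum_ite_eq_visits (A : Finset ℤ) (N : ℕ) (w : ℕ → ℤ) :
    ∑ n ∈ Finset.Icc 1 N, ∑ x ∈ A, (if w n = x then (1 : ℝ≥0∞) else 0) = visits A N w := by
  simp only [Finset.sum_ite_eq, Finset.sum_boole, visits]

theorem cumulativeOccupation_eq {Ω : Type*} (ξ₀ : ℤ → Ω → ℕ) (X : ℤ → ℕ → ℕ → Ω → ℤ) (A : Finset ℤ)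
    (N : ℕ) (ω : Ω) :
    cumulativeOccupation ξ₀ X A N ω
      = ∑' y : ℤ, ∑ i ∈ Finset.range (ξ₀ y ω), (visits A N fun n => X y i n ω : ℝ≥0∞) := by
  unfold cumulativeOccupation occupation
  simp_rw [← Summable.tsum_finsetSum fun _ _ => ENNReal.summable]
  refine tsum_congr fun y => ?_
  simp_rw [← sum_ite_eq_visits]
  exact (Finset.sum_congr rfl fun n _ => Finset.sum_comm).trans Finset.sum_comm

theorem distinctVisitors_eq {Ω : Type*} (ξ₀ : ℤ → Ω → ℕ) (X : ℤ → ℕ → ℕ → Ω → ℤ) (A : Finset ℤ)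
    (N : ℕ) (ω : Ω) :
    distinctVisitors ξ₀ X A N ω = ∑' y : ℤ, ∑ i ∈ Finset.range (ξ₀ y ω),
      ((min (visits A N fun n => X y i n ω) 1 : ℕ) : ℝ≥0∞) := by
  unfold distinctVisitors
  refine tsum_congr fun y => Finset.sum_congr rfl fun i _ => ?_
  have h : (∃ m ∈ Finset.Icc 1 N, X y i m ω ∈ A) ↔ 0 < visits A N fun n => X y i n ω := by
    rw [visits, Finset.card_pos, Finset.filter_nonempty_iff]
  by_cases h0 : ∃ m ∈ Finset.Icc 1 N, X y i m ω ∈ A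
  · rw [if_pos h0, min_eq_right (h.1 h0), Nat.cast_one]
  · rw [if_neg h0, Nat.eq_zero_of_not_pos (mt h.2 h0)]
    simp

/-- Only walks that start at distance at most `N` from `A` contribute, so the sum over all particles
of a function `g` of the number of visits is almost surely a finite Poisson sum of marks. Its mark
intensity has moments `lam * m₂` and `lam * m₃`. -/
theorem normal_approx_of_visits {Ω : Type*} [MeasurableSpace Ω] {P : Measure Ω}
    [IsProbabilityMeasure P] {lam : ℝ≥0} (hlam : 0 < lam)
    {ξ₀ : ℤ → Ω → ℕ} {X : ℤ → ℕ → ℕ → Ω → ℤ} (h : IsPoissonWalkSystem lam ξ₀ X P)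
    (A : Finset ℤ) (N : ℕ) {g : ℕ → ℕ} (hg0 : g 0 = 0) (hg : ∀ l, g l ≤ l) {U : Ω → ℝ≥0∞}
    (hU : ∀ ω, U ω
      = ∑' y : ℤ, ∑ i ∈ Finset.range (ξ₀ y ω), (g (visits A N fun n => X y i n ω) : ℝ≥0∞)) :
    ∃ m₂ m₃ : ℝ, 0 ≤ m₂ ∧ 0 ≤ m₃ ∧
      ENNReal.ofReal m₂ = ∑' y, visitExp A (fun i => (g i : ℝ≥0∞) ^ 2) N y 0 ∧
      ENNReal.ofReal m₃ = ∑' y, visitExp A (fun i => (g i : ℝ≥0∞) ^ 3) N y 0 ∧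
      (0 < m₂ → (∀ᵐ ω ∂P, U ω ≠ ∞) ∧ MemLp (fun ω => (U ω).toReal) 2 P ∧
        0 < Var[fun ω => (U ω).toReal; P] ∧
        wassersteinDist (P.map (standardize (fun ω => (U ω).toReal) P)) (gaussianReal 0 1)
          ≤ ENNReal.ofReal (12 * (lam * m₃) / √(lam * m₂) ^ 3)) := by
  set S : Finset ℤ := A.biUnion fun a => Finset.Icc (a - N) (a + N) with hS
  set Y : ℤ → ℕ → Ω → ℝ := fun y i ω => (g (visits A N fun n => X y i n ω) : ℝ) with hY
  have hpath : ∀ y i, Measurable fun ω n => X y i n ω := fun y i => (h.walk y i).measurable_path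
  have hvisX : ∀ y i, Measurable fun ω => visits A N fun n => X y i n ω := fun y i =>
    (measurable_visits A N).comp (hpath y i)
  have hgm : Measurable fun l : ℕ => (g l : ℝ) := measurable_of_countable _
  have hvis : Measurable fun w : ℕ → ℤ => (g (visits A N w) : ℝ) :=
    hgm.comp (measurable_visits A N)
  have hYm : ∀ y i, Measurable (Y y i) := fun y i => hvis.comp (hpath y i)
  have hYlaw : ∀ y i, P.map (Y y i) = P.map (Y y 0) := by
    intro y i
    have h1 := congrArg (Measure.map fun l : ℕ => (g l : ℝ))
      ((h.walk y i).map_visits_eq (h.walk y 0) A N)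
    rw [Measure.map_map hgm (hvisX y i), Measure.map_map hgm (hvisX y 0)] at h1
    exact h1
  have hYi : iIndepFun (fun p : ℤ × ℕ => Y p.1 p.2) P :=
    h.indep_walks.comp (fun _ w => (g (visits A N w) : ℝ)) fun _ => hvis
  have hξY : IndepFun (fun ω y => ξ₀ y ω) (fun ω (p : ℤ × ℕ) => Y p.1 p.2 ω) P := by
    have hψ : Measurable fun (W : ℤ × ℕ → ℕ → ℤ) p => (g (visits A N (W p)) : ℝ) :=
      measurable_pi_lambda _ fun p => hvis.comp (measurable_pi_apply p)
    exact h.indep_init_walks.comp (φ := fun k => k) measurable_id hψ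
  have hY0 : ∀ y i ω, 0 ≤ Y y i ω := fun y i ω => Nat.cast_nonneg _
  have hYB : ∀ y i ω, Y y i ω ≤ N := fun y i ω =>
    Nat.cast_le.2 ((hg _).trans (visits_le _ _ _))
  have hzero : ∀ y ∉ S, ∀ i, ∀ᵐ ω ∂P, (visits A N fun n => X y i n ω) = 0 := by
    intro y hy i
    have h1 : ∀ a ∈ A, (N : ℤ) < |y - a| := by
      intro a ha
      by_contra! hle
      refine hy (Finset.mem_biUnion.2 ⟨a, ha, Finset.mem_Icc.2 ?_⟩)
      rw [abs_le] at hle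
      constructor <;> lia
    have h2 := (h.walk y i).lintegral_visits A N fun l => (l : ℝ≥0∞) ^ 1
    have hm : Measurable fun l : ℕ => (l : ℝ≥0∞) ^ 1 := measurable_of_countable _
    have hmX : Measurable fun ω => ((visits A N fun n => X y i n ω : ℕ) : ℝ≥0∞) ^ 1 :=
      hm.comp (hvisX y i)
    rw [show visitExp A (fun l => (l : ℝ≥0∞) ^ 1) N y 0 = 0 from visitMoment_one_eq_zero h1,
      lintegral_eq_zero_iff hmX] at h2
    filter_upwards [h2] with ω hω
    simpa using hω
  have hall : ∀ᵐ ω ∂P, ∀ y ∉ S, ∀ i, (visits A N fun n => X y i n ω) = 0 := by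
    rw [ae_all_iff]
    intro y
    by_cases hy : y ∈ S
    · exact Eventually.of_forall fun ω hn => absurd hy hn
    · filter_upwards [ae_all_iff.2 (hzero y hy)] with ω hω _ using hω
  have hUV : ∀ᵐ ω ∂P, U ω = ENNReal.ofReal (markSum S ξ₀ Y ω) := by
    filter_upwards [hall] with ω hω
    rw [hU ω, tsum_eq_sum (s := S) fun y hy => Finset.sum_eq_zero fun i _ => by
      rw [hω y hy i, hg0, Nat.cast_zero], markSum, ENNReal.ofReal_sum_of_nonneg fun y _ =>
        Finset.sum_nonneg fun i _ => hY0 y i ω]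
    refine Finset.sum_congr rfl fun y _ => ?_
    rw [ENNReal.ofReal_sum_of_nonneg fun i _ => hY0 y i ω]
    refine Finset.sum_congr rfl fun i _ => ?_
    rw [hY, ENNReal.ofReal_natCast]
  have hmom : ∀ k ≠ 0, ENNReal.ofReal (∑ y ∈ S, ∫ ω, Y y 0 ω ^ k ∂P)
      = ∑' y, visitExp A (fun i => (g i : ℝ≥0∞) ^ k) N y 0 := by
    intro k hk
    have hnn : ∀ y ω, 0 ≤ Y y 0 ω ^ k := fun y ω => pow_nonneg (hY0 y 0 ω) k
    rw [tsum_eq_sum (s := S) fun y hy => ?_, ENNReal.ofReal_sum_of_nonneg fun y _ =>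
      integral_nonneg (hnn y)]
    · refine Finset.sum_congr rfl fun y _ => ?_
      rw [ofReal_integral_eq_lintegral_ofReal ?_ (Eventually.of_forall (hnn y)),
        ← (h.walk y 0).lintegral_visits A N]
      · refine lintegral_congr fun ω => ?_
        rw [ENNReal.ofReal_pow (hY0 y 0 ω), hY, ENNReal.ofReal_natCast]
      · refine Integrable.of_bound ((hYm y 0).pow_const k).aestronglyMeasurable ((N : ℝ) ^ k)
          (Eventually.of_forall fun ω => ?_)
        rw [Real.norm_of_nonneg (hnn y ω)]
        exact pow_le_pow_left₀ (hY0 y 0 ω) (hYB y 0 ω) k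
    · rw [← (h.walk y 0).lintegral_visits A N]
      have h1 : ∀ᵐ ω ∂P, (g (visits A N fun m => X y 0 m ω) : ℝ≥0∞) ^ k = 0 := by
        filter_upwards [hzero y hy 0] with ω hω
        rw [hω, hg0, Nat.cast_zero, zero_pow hk]
      rw [lintegral_congr_ae h1, lintegral_zero]
  have hnn : ∀ k : ℕ, 0 ≤ ∑ y ∈ S, ∫ ω, Y y 0 ω ^ k ∂P := fun k =>
    Finset.sum_nonneg fun y _ => integral_nonneg fun ω => pow_nonneg (hY0 y 0 ω) k
  refine ⟨_, _, hnn 2, hnn 3, hmom 2 two_ne_zero, hmom 3 three_ne_zero, fun hpos => ⟨?_, ?_⟩⟩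
  · filter_upwards [hUV] with ω hω
    rw [hω]
    exact ENNReal.ofReal_ne_top
  · refine normal_approx_of_ae_eq_markSum h.measurable_init h.law_init h.indep_init hYm hYlaw hYi
      hξY hY0 hYB (S := S) ?_ (mul_pos (by exact_mod_cast hlam) hpos) rfl rfl
    filter_upwards [hUV] with ω hω
    rw [hω, ENNReal.toReal_ofReal]
    exact Finset.sum_nonneg fun y _ => Finset.sum_nonneg fun i _ => hY0 y i ω

/-- All the powers of `N` that occur are integer powers of `t = N ^ (1 / 4)`. -/
theorem rpow_neg_quarter_eq {N : ℕ} (hN : 1 ≤ N) :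
    ∃ t : ℝ, 0 < t ∧ (N : ℝ) ^ (-(1 / 4) : ℝ) = t⁻¹ ∧ √(N : ℝ) = t ^ 2 ∧ (N : ℝ) = t ^ 4 := by
  have hN0 : (0 : ℝ) < N := by exact_mod_cast hN
  have h4 : ((N : ℝ) ^ (1 / 4 : ℝ)) ^ 4 = N := by
    rw [← Real.rpow_natCast, ← Real.rpow_mul hN0.le]
    norm_num
  have ht : 0 < (N : ℝ) ^ (1 / 4 : ℝ) := Real.rpow_pos_of_pos hN0 _
  refine ⟨(N : ℝ) ^ (1 / 4 : ℝ), ht, Real.rpow_neg hN0.le _, ?_, h4.symm⟩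
  rw [Real.sqrt_eq_iff_mul_self_eq_of_pos (by positivity)]
  linear_combination h4

theorem ratio_le_of_growth {lam m₂ m₃ a b t : ℝ} (hlam : 0 < lam) (ha : 0 < a) (ht : 0 < t)
    (h2 : a * t ^ 6 ≤ m₂) (h3 : m₃ ≤ b * t ^ 8) (hb : 0 ≤ b) :
    12 * (lam * m₃) / √(lam * m₂) ^ 3 ≤ 12 * lam * b / √(lam * a) ^ 3 * t⁻¹ := by
  have h1 : √(lam * a) * t ^ 3 ≤ √(lam * m₂) := by
    refine Real.le_sqrt_of_sq_le ?_
    rw [mul_pow, Real.sq_sqrt (by positivity)]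
    nlinarith
  have hs : 0 < √(lam * a) := Real.sqrt_pos.2 (by positivity)
  calc 12 * (lam * m₃) / √(lam * m₂) ^ 3
      ≤ 12 * (lam * (b * t ^ 8)) / (√(lam * a) * t ^ 3) ^ 3 := by gcongr
    _ = 12 * lam * b / √(lam * a) ^ 3 * t⁻¹ := by
        field_simp

theorem ratio_le_of_growth_of_eq {lam m a t : ℝ} (hlam : 0 < lam) (ha : 0 < a) (ht : 0 < t)
    (h : a * t ^ 2 ≤ m) :
    12 * (lam * m) / √(lam * m) ^ 3 ≤ 12 / √(lam * a) * t⁻¹ := by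
  have hm : 0 < m := lt_of_lt_of_le (by positivity) h
  have h1 : √(lam * a) * t ≤ √(lam * m) := by
    refine Real.le_sqrt_of_sq_le ?_
    rw [mul_pow, Real.sq_sqrt (by positivity)]
    nlinarith
  have hs : 0 < √(lam * a) := Real.sqrt_pos.2 (by positivity)
  have hs' : 0 < √(lam * m) := Real.sqrt_pos.2 (by positivity)
  have hsq : √(lam * m) ^ 2 = lam * m := Real.sq_sqrt (by positivity)
  calc 12 * (lam * m) / √(lam * m) ^ 3 = 12 / √(lam * m) := by
        rw [div_eq_div_iff (by positivity) (by positivity)]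
        linear_combination -12 * √(lam * m) * hsq
    _ ≤ 12 / (√(lam * a) * t) := by gcongr
    _ = 12 / √(lam * a) * t⁻¹ := by
        field_simp

end PoissonWalks

theorem theorem1p1 (lam : ℝ≥0) (hlam : 0 < lam) (A : Finset ℤ) (hA : A.Nonempty) :
    ∃ C₁ : ℝ, 0 < C₁ ∧ ∃ C₂ : ℝ, 0 < C₂ ∧
      ∀ (Ω : Type*) [MeasurableSpace Ω] (P : Measure Ω) [IsProbabilityMeasure P]
        (ξ₀ : ℤ → Ω → ℕ) (X : ℤ → ℕ → ℕ → Ω → ℤ),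
        PoissonWalks.IsPoissonWalkSystem lam ξ₀ X P →
        ∀ (N : ℕ), 1 ≤ N →
        ∀ (W D : Ω → ℝ),
          W = (fun ω => (PoissonWalks.cumulativeOccupation ξ₀ X A N ω).toReal) →
          D = (fun ω => (PoissonWalks.distinctVisitors ξ₀ X A N ω).toReal) →
          ((∀ᵐ ω ∂P, PoissonWalks.cumulativeOccupation ξ₀ X A N ω ≠ ∞) ∧
            MemLp W 2 P ∧ 0 < Var[W; P] ∧
            PoissonWalks.wassersteinDist (P.map (PoissonWalks.standardize W P)) (gaussianReal 0 1)
              ≤ ENNReal.ofReal (C₁ * (N : ℝ) ^ (-(1 / 4) : ℝ))) ∧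
          ((∀ᵐ ω ∂P, PoissonWalks.distinctVisitors ξ₀ X A N ω ≠ ∞) ∧
            MemLp D 2 P ∧ 0 < Var[D; P] ∧
            PoissonWalks.wassersteinDist (P.map (PoissonWalks.standardize D P)) (gaussianReal 0 1)
              ≤ ENNReal.ofReal (C₂ * (N : ℝ) ^ (-(1 / 4) : ℝ))) := by
  have hl : (0 : ℝ) < lam := by exact_mod_cast hlam
  have hc : (0 : ℝ) < A.card := by exact_mod_cast hA.card_pos
  refine ⟨12 * lam * (40 * A.card ^ 3) / √(lam * (1 / 54)) ^ 3, by positivity,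
    12 / √(lam * (1 / 4)), by positivity, ?_⟩
  intro Ω _ P _ ξ₀ X h N hN W D hW hD
  obtain ⟨t, ht, hpow, hsqrt, hNt⟩ := PoissonWalks.rpow_neg_quarter_eq hN
  subst hW hD
  constructor
  · obtain ⟨m₂, m₃, h20, h30, h2, h3, key⟩ := PoissonWalks.normal_approx_of_visits hlam h A N
      (g := fun l => l) rfl (fun _ => le_rfl) (PoissonWalks.cumulativeOccupation_eq ξ₀ X A N)
    have h2' : N * √(N : ℝ) / 54 ≤ m₂ := by
      rw [← ENNReal.ofReal_le_ofReal_iff h20, h2]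
      exact PoissonWalks.le_tsum_visitMoment_two hA hN
    have h3' : m₃ ≤ 40 * A.card ^ 3 * (N : ℝ) ^ 2 := by
      rw [← ENNReal.ofReal_le_ofReal_iff (by positivity), h3]
      exact PoissonWalks.tsum_visitMoment_three_le hA hN
    have hpos : 0 < m₂ := lt_of_lt_of_le (by rw [hsqrt, hNt]; positivity) h2'
    obtain ⟨k1, k2, k3, k4⟩ := key hpos
    refine ⟨k1, k2, k3, k4.trans (ENNReal.ofReal_le_ofReal ?_)⟩
    rw [hpow]
    refine PoissonWalks.ratio_le_of_growth hl (by norm_num) ht ?_ ?_ (by positivity)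
    · refine le_of_eq_of_le ?_ h2'
      rw [hsqrt, hNt]
      ring
    · refine h3'.trans_eq ?_
      rw [hNt]
      ring
  · obtain ⟨m₂, m₃, h20, h30, h2, h3, key⟩ := PoissonWalks.normal_approx_of_visits hlam h A N
      (g := fun l => min l 1) rfl (fun _ => min_le_left _ _)
      (PoissonWalks.distinctVisitors_eq ξ₀ X A N)
    -- the marks are indicators, so that all their moments agree
    have hind : ∀ k ≠ 0, (fun i : ℕ => ((min i 1 : ℕ) : ℝ≥0∞) ^ k)
        = fun i : ℕ => ((min i 1 : ℕ) : ℝ≥0∞) := by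
      intro k hk
      funext i
      rcases Nat.eq_zero_or_pos i with rfl | hi
      · simp [hk]
      · simp [min_eq_right (Nat.one_le_iff_ne_zero.2 hi.ne')]
    rw [hind 2 two_ne_zero] at h2
    rw [hind 3 three_ne_zero, ← h2, ENNReal.ofReal_eq_ofReal_iff h30 h20] at h3
    subst h3
    have h2' : √(N : ℝ) / 4 ≤ m₃ := by
      rw [← ENNReal.ofReal_le_ofReal_iff h20, h2]
      exact PoissonWalks.le_tsum_hitProb hA hN
    have hpos : 0 < m₃ := lt_of_lt_of_le (by rw [hsqrt]; positivity) h2'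
    obtain ⟨k1, k2, k3, k4⟩ := key hpos
    refine ⟨k1, k2, k3, k4.trans (ENNReal.ofReal_le_ofReal ?_)⟩
    rw [hpow]
    refine PoissonWalks.ratio_le_of_growth_of_eq hl (by norm_num) ht ?_
    refine le_of_eq_of_le ?_ h2'
    rw [hsqrt]
    ring
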